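/- Let $\tau\subseteq\sigma$ be finite relational signatures and $\mathbf B=(\mathcal B_n:n\in\mathbb N^+)$ a sequence of finite $\tau$-structures with domains $B_n$. Let $\mathrm{dist}$ denote distance in the Gaifman graph of the $\tau$-reduct of a structure. **Types and closures.** Let $\tau\subseteq\sigma_0\subseteq\sigma$ and $\lambda\in\mathbb N$. A complete $(\sigma_0,0)$-neighbourhood type in variables $\bar x$ is a consistent conjunction of $\sigma_0$-literals in $\bar x$ that decides every equality between, and every $\sigma_0$-relation on, variables in $\bar x$. For $\lambda\ge 1$, a complete $(\sigma_0,\lambda)$-neighbourhood type is a consistent formula $\exists\bar y\,(\bigwedge_i\mathrm{dist}(y_i,\bar x)\le\lambda\wedge\forall z(\mathrm{dist}(z,\bar x)\le\lambda\to\bigvee_i z=y_i)\wedge q(\bar x,\bar y))$, where $q$ is a complete $(\sigma_0,0)$-neighbourhood type. Let $\approx_p$ be the relation $p\models\mathrm{dist}(x_i,x_j)\le 2\lambda$ on the variables of $p$, and $\sim_p$ its transitive closure. An element $b\in B_n$ is $\lambda$-rare if it satisfies a complete $(\tau,\lambda)$-neighbourhood type $p(x)$ for which $|p(\mathcal B_m)|$,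 $m\in\mathbb N^+$, is bounded. A complete $(\sigma_0,\lambda)$-closure type in $\bar x$ is a formula $\exists\bar y\,(\bigwedge_i``y_i\text{ is }\lambda\text{-rare}"\wedge\forall u(``u\text{ is }\lambda\text{-rare}"\to\bigvee_i u=y_i)\wedge q(\bar x,\bar y))$, where $q$ is a complete $(\sigma_0,\lambda)$-neighbourhood type. **Assumptions on $\mathbf B$.** $|B_n|\to\infty$; the degrees of the Gaifman graphs are bounded by one constant $\Delta$; $|B_n|\le P(n)$ for some polynomial $P$; and for every complete $(\tau,\lambda)$-neighbourhood type $p$ all of whose variables are $\sim_p$-equivalent, either $|p(\mathcal B_n)|$ is bounded, or there is $f:\mathbb N^+\to\mathbb R$ such that $f(n)-\alpha\ln n\to\infty$ for all $\alpha\in\mathbb R$ and $|p(\mathcal B_n)|\ge f(n)$ for all large $n$. **Network.** $PLA^*(\sigma_0)$ is the $[0,1]$-valued logic built from constants $c\in[0,1]$, equalities and $\sigma_0$-atoms by continuous connectives $[0,1]^k\to[0,1]$ and by aggregations $F(\varphi_1,\dots,\varphi_k:\bar y:\chi_1,\dots,\chi_k)$, where $k\ge1$ and $F:([0,1]^{<\omega})^k\to[0,1]$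 is invariant under reordering each of its argument sequences. The value of such an aggregation is $F$ applied to the sequences of values of $\varphi_i(\bar a,\bar b)$ over all $\bar b$ with $\chi_i(\bar a,\bar b)=1$, and $0$ if one of these sequences is empty. A $PLA^*(\sigma)$-network $\mathbb G$ based on $\tau$ consists of a DAG on $\sigma\setminus\tau$ and, for each $R\in\sigma\setminus\tau$ of arity $r$, a formula $\theta_R(x_1,\dots,x_r)\in PLA^*(\tau\cup\mathrm{par}(R))$, where $\mathrm{par}(R)$ is the set of parents of $R$. Let $\mathbf W_n$ be the set of expansions of $\mathcal B_n$ to $\sigma$, with the induced distribution $$\mathbb P_n(\mathcal A)=\prod_{R\in\sigma\setminus\tau}\ \prod_{\bar a\in R^{\mathcal A}}\mathcal A(\theta_R(\bar a))\prod_{\bar a\notin R^{\mathcal A}}\bigl(1-\mathcal A(\theta_R(\bar a))\bigr).$$ Let $\rho$ be the length of the longest directed path of the DAG ($-1$ if $\sigma=\tau$), let $\sigma'=\tau\cup\{R\in\sigma\setminus\tau:\mathrm{mp}(R)<\rho\}$, where $\mathrm{mp}(R)$ is the length of the longest directed path ending in $R$, and let $\mathbb G'$, $\mathbf W'_n$,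 $\mathbb P'_n$ be the subnetwork induced by $\sigma'$, the set of expansions of $\mathcal B_n$ to $\sigma'$, and the distribution on it induced by $\mathbb G'$. A pair $(\varphi(\bar x),\psi(\bar x))$ **converges** with respect to $\mathbb G$ if there is $\alpha\in[0,1]$ such that for every $\varepsilon>0$, all sufficiently large $n$ and all $\bar a\in B_n^{|\bar x|}$ with $\mathbb P_n(\psi(\bar a))>0$, one has $\mathbb P_n(\varphi(\bar a)\mid\psi(\bar a))\in[\alpha-\varepsilon,\alpha+\varepsilon]$. Likewise for $\mathbb G'$ and $\mathbb P'_n$. A triple $(\varphi(\bar x,\bar y),\psi(\bar x,\bar y),\chi(\bar x))$ is **balanced** with respect to $\mathbb G'$ if for some $\alpha\in[0,1]$ and every $\varepsilon>0$, the $\mathbb P'_n$-probability that $$(\alpha-\varepsilon)|\psi(\bar a,\mathcal A)|\le|\varphi(\bar a,\mathcal A)\cap\psi(\bar a,\mathcal A)|\le(\alpha+\varepsilon)|\psi(\bar a,\mathcal A)|$$ for all $\bar a$ with $\mathcal A\models\chi(\bar a)$ tends to $1$. Here $\varphi(\bar a,\mathcal A)$ is the set of all $\bar b$ with $\mathcal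 A\models\varphi(\bar a,\bar b)$. A complete $(\tau,\lambda)$-closure type $p(\bar x,\bar y)$ is **strongly $\bar y$-unbounded** if for every nonempty subsequence $\bar y'$ of $\bar y$ the restriction $q$ of $p$ to $\bar x\bar y'$ (the complete $(\tau,\lambda)$-closure type in these variables that is consistent with $p$) is satisfied in $\mathcal B_n$ for arbitrarily large $n$ and there is $f$ such that $f(n)-\alpha\ln n\to\infty$ for all $\alpha>0$ and $|q(\bar a,\mathcal B_n)|\ge f(n)$ whenever $q(\bar a,\mathcal B_n)\neq\emptyset$. The number $\dim_{\bar y}(p)$ is the number of $\sim_p$-classes that contain only variables of $\bar y$ and to which the restriction of $p$ has an unbounded number of realizations in the $\mathcal B_n$. **Induction hypothesis** for $\kappa,\kappa'\in\mathbb N$: 1. For every $R\in\sigma\setminus\tau$ there is a formula $\chi_R(\bar x)=\bigwedge_{i}(\varphi_i(\bar x)\to c_i)$, a finite conjunction in which $c_i\in[0,1]$ and each $\varphi_i$ is a complete $(\sigma',\lambda_i)$-closure type with $\lambda_i\le\kappa$ (or $\top$, if $\bar x$ is empty), where $\wedge$ is the minimum and $u\to v$ is $\min(1,1-u+v)$,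 such that for every $\varepsilon>0$ the probability $\mathbb P'_n(\exists\bar a:|\mathcal A(\theta_R(\bar a))-\mathcal A(\chi_R(\bar a))|>\varepsilon)$ tends to $0$. 2. For all $\lambda$ and all $\gamma\ge\kappa'$, if $p'(\bar x)$ is a complete $(\sigma',\lambda)$-closure type and $p_\tau(\bar x)$ is a complete $(\tau,\lambda+\gamma)$-closure type, then $(p',p_\tau)$ converges with respect to $\mathbb G'$. 3. For all $\lambda$ and all $\gamma\ge\kappa'$, if $p'(\bar x,\bar y)$ and $q'(\bar x)$ are complete $(\sigma',\lambda)$-closure types and $p_\tau(\bar x,\bar y)$ is a complete $(\tau,\lambda+\gamma)$-closure type that is strongly $\bar y$-unbounded with $\dim_{\bar y}(p_\tau)=1$, then $(p',p_\tau,q')$ is balanced with respect to $\mathbb G'$. **Proposition.** Suppose that the assumptions on $\mathbf B$ hold and that the induction hypothesis holds for $\kappa,\kappa'$. Let $\lambda\in\mathbb N$ and $\gamma\ge\kappa'$, let $p(\bar x)$ be a complete $(\sigma,\lambda)$-closure type and let $p_\tau(\bar x)$ be a complete $(\tau,\lambda+\kappa+\gamma)$-closure type. Then $(p,p_\tau)$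 converges with respect to $\mathbb G$. -/

import Mathlib

noncomputable section

namespace PLANet

/-! ## Finite relational signatures, structures, reducts -/

/-- A pair `τ ⊆ σ` of finite relational signatures: `σ` is the set of all symbols `Sym` (with their
arities) and `τ` is the subset `tau`. -/
structure Signatures where
  Sym : Type
  [fintypeSym : Fintype Sym]
  arity : Sym → ℕ
  tau : Set Sym

attribute [instance] Signatures.fintypeSym

/-- A signature `S` with `τ ⊆ S ⊆ σ`. -/
structure Sig (V : Signatures) where
  carrier : Set V.Sym
  tau_subset : V.tau ⊆ carrier

/-- The signature `τ`. -/
def Sig.base (V : Signatures) : Sig V := ⟨V.tau, subset_rfl⟩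

/-- The signature `σ`. -/
def Sig.full (V : Signatures) : Sig V := ⟨Set.univ, Set.subset_univ _⟩

variable {V : Signatures}

/-- `S`-structures with domain `D`. -/
abbrev Str (S : Sig V) (D : Type) : Type :=
  ∀ R : S.carrier, (Fin (V.arity R) → D) → Prop

/-- The reduct of a `T`-structure to `S ⊆ T`. -/
def reduct {S T : Sig V} {D : Type} (h : S.carrier ⊆ T.carrier) (A : Str T D) : Str S D :=
  fun R => A ⟨R, h R.2⟩

/-! ## The logic `PLA*` -/

/-- A `k`-ary aggregation function `([0,1]^{<ω})^k → [0,1]`. A function of nonempty finite sequences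
which is invariant under reorderings of each of its arguments is a function of nonempty finite
multisets. -/
abbrev AggFun (k : ℕ) : Type := (Fin k → {s : Multiset unitInterval // s ≠ 0}) → unitInterval

/-- The formulas of `PLA*(S)` with free variables among `x_0, …, x_{n-1}`. Connectives are continuous
functions `[0,1]^k → [0,1]` with `k ≥ 1`; the aggregation
`F(φ_1, …, φ_k : y_1, …, y_m : χ_1, …, χ_k)`, `k ≥ 1`, binds the last `m` variables. -/
inductive PLA (S : Sig V) : ℕ → Type
  | const {n : ℕ} (c : unitInterval) : PLA S n
  | eq {n : ℕ} (i j : Fin n) : PLA S n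
  | rel {n : ℕ} (R : S.carrier) (v : Fin (V.arity R) → Fin n) : PLA S n
  | conn {n k : ℕ} (C : (Fin (k + 1) → unitInterval) → unitInterval) (hC : Continuous C)
      (φ : Fin (k + 1) → PLA S n) : PLA S n
  | agg {n k : ℕ} (F : AggFun (k + 1)) (m : ℕ) (φ χ : Fin (k + 1) → PLA S (n + m)) : PLA S n

open Classical in
/-- The value `A(φ(a)) ∈ [0,1]`. -/
def PLA.eval {S : Sig V} {D : Type} [Fintype D] (A : Str S D) :
    {n : ℕ} → PLA S n → (Fin n → D) → unitInterval
  | _, .const c, _ => c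
  | _, .eq i j, a => if a i = a j then 1 else 0
  | _, .rel R v, a => if A R (a ∘ v) then 1 else 0
  | _, .conn C _ φ, a => C fun i => (φ i).eval A a
  | _, .agg F m φ χ, a =>
      let p : ∀ _, Multiset unitInterval := fun i =>
        (Finset.univ.filter fun b : Fin m → D => (χ i).eval A (Fin.append a b) = 1).val.map
          fun b => (φ i).eval A (Fin.append a b)
      if h : ∀ i, p i ≠ 0 then F fun i => ⟨p i, h i⟩ else 0

/-! ## Gaifman graph, neighbourhood types

A finite sequence of distinct variables is represented by a finite index type `X`, and a tuple of
values for it by a function on `X`; `X ⊕ Y` stands for the concatenation of two such sequences. -/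

/-- The Gaifman graph of the `τ`-reduct. -/
def gaifman {S : Sig V} {D : Type} (A : Str S D) : SimpleGraph D where
  Adj a b := a ≠ b ∧ ∃ (R : V.Sym) (hR : R ∈ V.tau) (c : Fin (V.arity R) → D),
    A ⟨R, S.tau_subset hR⟩ c ∧ a ∈ Set.range c ∧ b ∈ Set.range c
  symm := ⟨fun _ _ ⟨h, R, hR, c, hc, ha, hb⟩ => ⟨h.symm, R, hR, c, hc, hb, ha⟩⟩
  loopless := ⟨fun _ h => h.1 rfl⟩

/-- `dist(a, b) ≤ l`; distances are always computed in the `τ`-reduct. -/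
def DistLE {S : Sig V} {D : Type} (A : Str S D) (l : ℕ) (a b : D) : Prop :=
  (gaifman A).edist a b ≤ (l : ℕ∞)

/-- A conjunction of `S`-literals in the variables `X` that decides every atomic `S`-formula:
`eq x y` and `rel R v` say which atomic formulas occur positively. -/
structure Diagram (S : Sig V) (X : Type) where
  eq : X → X → Prop
  rel : ∀ R : S.carrier, (Fin (V.arity R) → X) → Prop

/-- `A ⊨ p(a)` for a conjunction `p` of literals as above. -/
def Diagram.Sat {S : Sig V} {X D : Type} (p : Diagram S X) (A : Str S D) (a : X → D) : Prop :=
  (∀ x y, a x = a y ↔ p.eq x y) ∧ ∀ R v, A R (a ∘ v) ↔ p.rel R v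

/-- The truth in `A` at `a` of the formula
`∃ y_1 … y_l (⋀ dist(y_i, x) ≤ lam ∧ ∀ z (dist(z, x) ≤ lam → ⋁ z = y_i) ∧ p(x, y))`. -/
def NbhdSat {S : Sig V} {X D : Type} {l : ℕ} (lam : ℕ) (p : Diagram S (X ⊕ Fin l))
    (A : Str S D) (a : X → D) : Prop :=
  ∃ y : Fin l → D,
    (∀ i, ∃ x, DistLE A lam (y i) (a x)) ∧
    (∀ z, (∃ x, DistLE A lam z (a x)) → ∃ i, z = y i) ∧
    p.Sat A (Sum.elim a y)

/-- A complete `(S, lam)`-neighbourhood type in the variables `X`: a formula of the form above which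
is consistent (has a finite model). For `lam = 0` the `y_i` just list the values of the variables in
`X`, so these formulas are, up to equivalence, the consistent conjunctions of literals in `X` that
decide every atomic formula, that is, the complete `(S, 0)`-neighbourhood types. -/
structure NbhdType (S : Sig V) (lam : ℕ) (X : Type) where
  l : ℕ
  diagram : Diagram S (X ⊕ Fin l)
  consistent : ∃ (D : Type) (_ : Finite D) (A : Str S D) (a : X → D), NbhdSat lam diagram A a

/-- `A ⊨ p(a)`. -/
def NbhdType.Sat {S : Sig V} {lam : ℕ} {X D : Type} (p : NbhdType S lam X) (A : Str S D)
    (a : X → D) : Prop :=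
  NbhdSat lam p.diagram A a

/-- The relation `x ≈_p y`: `p ⊨ dist(x, y) ≤ 2 lam` (in all finite structures). -/
def NbhdType.Approx {S : Sig V} {lam : ℕ} {X : Type} (p : NbhdType S lam X) (x y : X) : Prop :=
  ∀ (D : Type) [Finite D] (A : Str S D) (a : X → D), p.Sat A a → DistLE A (2 * lam) (a x) (a y)

/-- The relation `x ∼_p y`, the transitive closure of `≈_p`. -/
def NbhdType.Sim {S : Sig V} {lam : ℕ} {X : Type} (p : NbhdType S lam X) : X → X → Prop :=
  Relation.TransGen p.Approx

/-! ## The base sequence -/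

/-- A sequence `(B_n : n ∈ ℕ⁺)` of finite `τ`-structures. -/
structure BaseSeq (V : Signatures) where
  dom : ℕ+ → Type
  [fintypeDom : ∀ n, Fintype (dom n)]
  str : ∀ n, Str (Sig.base V) (dom n)

attribute [instance] BaseSeq.fintypeDom

/-- `f(n) - α ln n → ∞` for all real `α`. -/
def SuperLog (f : ℕ+ → ℝ) : Prop :=
  ∀ α : ℝ, Filter.Tendsto (fun n : ℕ+ => f n - α * Real.log ((n : ℕ) : ℝ)) Filter.atTop
    Filter.atTop

/-- The standing assumptions on the base sequence. -/
structure BaseSeq.Admissible (B : BaseSeq V) : Prop where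
  card_tendsto : Filter.Tendsto (fun n => Fintype.card (B.dom n)) Filter.atTop Filter.atTop
  degree_bounded : ∃ Δ : ℕ, ∀ n (b : B.dom n), ((gaifman (B.str n)).neighborSet b).ncard ≤ Δ
  card_le_poly : ∃ P : Polynomial ℝ, ∀ n : ℕ+,
    (Fintype.card (B.dom n) : ℝ) ≤ P.eval ((n : ℕ) : ℝ)
  dichotomy : ∀ (lam : ℕ) (X : Type) [Finite X] (p : NbhdType (Sig.base V) lam X), (∀ x y, p.Sim x y) →
    (∃ m : ℕ, ∀ n, {a | p.Sat (B.str n) a}.ncard ≤ m) ∨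
    (∃ f : ℕ+ → ℝ, SuperLog f ∧
      ∀ᶠ n in Filter.atTop, f n ≤ ({a | p.Sat (B.str n) a}.ncard : ℝ))

/-- `c ∈ B_n` is `lam`-rare: it satisfies a bounded complete `(τ, lam)`-neighbourhood type in one
variable. -/
def BaseSeq.Rare (B : BaseSeq V) (lam : ℕ) (n : ℕ+) (c : B.dom n) : Prop :=
  ∃ p : NbhdType (Sig.base V) lam (Fin 1),
    (∃ m : ℕ, ∀ n', {a | p.Sat (B.str n') a}.ncard ≤ m) ∧ p.Sat (B.str n) fun _ => c

/-- The set `W_n` of the `S`-structures that expand `B_n`. -/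
def BaseSeq.W (B : BaseSeq V) (S : Sig V) (n : ℕ+) : Type :=
  {A : Str S (B.dom n) // reduct (S := Sig.base V) S.tau_subset A = B.str n}

instance (B : BaseSeq V) (S : Sig V) (n : ℕ+) : Finite (B.W S n) := by
  unfold BaseSeq.W; infer_instance

instance (B : BaseSeq V) (S : Sig V) (n : ℕ+) : Fintype (B.W S n) := Fintype.ofFinite _

/-! ## Closure types -/

/-- A complete `(S, lam)`-closure type in the variables `X`: it is given by `k ∈ ℕ` and a complete
`(S, lam)`-neighbourhood type `p(x, y_1, …, y_k)`. -/
structure ClosureType (S : Sig V) (lam : ℕ) (X : Type) where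
  k : ℕ
  nbhd : NbhdType S lam (X ⊕ Fin k)

/-- The truth at `a`, in an expansion `A` of `B_n`, of the formula
`∃ y_1 … y_k (⋀ y_i is lam-rare ∧ ∀ u (u is lam-rare → ⋁ u = y_i) ∧ p(x, y_1, …, y_k))`. -/
def ClosureType.Sat {S : Sig V} {lam : ℕ} {X : Type} (p : ClosureType S lam X) (B : BaseSeq V)
    (n : ℕ+) (A : Str S (B.dom n)) (a : X → B.dom n) : Prop :=
  ∃ y : Fin p.k → B.dom n,
    (∀ i, B.Rare lam n (y i)) ∧
    (∀ u, B.Rare lam n u → ∃ i, u = y i) ∧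
    p.nbhd.Sat A (Sum.elim a y)

/-- The truth of a formula over `S` with free variables `X` in the expansions of the `B_n` to `S`. -/
abbrev Query (B : BaseSeq V) (S : Sig V) (X : Type) : Type :=
  ∀ n, B.W S n → (X → B.dom n) → Prop

/-- A closure type over `S ⊆ T` as a formula over `T`. -/
def ClosureType.toQuery {S : Sig V} {lam : ℕ} {X : Type} (p : ClosureType S lam X) (B : BaseSeq V)
    (T : Sig V) (h : S.carrier ⊆ T.carrier) : Query B T X :=
  fun n A a => p.Sat B n (reduct h A.1) a

/-- `q` is the restriction of `p` to the subsequence `e` of its variables: `q` is a closure type in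
these variables that is consistent with `p`. -/
def ClosureType.IsRestriction {lam : ℕ} {X E : Type} (B : BaseSeq V)
    (p : ClosureType (Sig.base V) lam X) (e : E → X) (q : ClosureType (Sig.base V) lam E) : Prop :=
  ∃ (n : ℕ+) (a : X → B.dom n), p.Sat B n (B.str n) a ∧ q.Sat B n (B.str n) (a ∘ e)

/-- `q(x, y)` is uniformly `y`-unbounded. -/
def ClosureType.UniformlyUnbounded {lam : ℕ} {X Y : Type} (B : BaseSeq V)
    (q : ClosureType (Sig.base V) lam (X ⊕ Y)) : Prop :=
  (∀ n₀ : ℕ+, ∃ n ≥ n₀, ∃ c, q.Sat B n (B.str n) c) ∧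
  ∃ f : ℕ+ → ℝ,
    (∀ α : ℝ, 0 < α → Filter.Tendsto (fun n : ℕ+ => f n - α * Real.log ((n : ℕ) : ℝ))
      Filter.atTop Filter.atTop) ∧
    ∀ n (a : X → B.dom n), {b : Y → B.dom n | q.Sat B n (B.str n) (Sum.elim a b)}.Nonempty →
      f n ≤ ({b : Y → B.dom n | q.Sat B n (B.str n) (Sum.elim a b)}.ncard : ℝ)

/-- `p(x, y)` is strongly `y`-unbounded: for every nonempty subsequence `y'` of `y`, the restriction
of `p` to `x y'` is uniformly `y'`-unbounded. -/
def ClosureType.StronglyUnbounded {lam : ℕ} {X Y : Type} (B : BaseSeq V)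
    (p : ClosureType (Sig.base V) lam (X ⊕ Y)) : Prop :=
  ∀ Y' : Set Y, Y'.Nonempty → ∃ q : ClosureType (Sig.base V) lam (X ⊕ Y'),
    p.IsRestriction B (Sum.map id Subtype.val) q ∧ q.UniformlyUnbounded B

/-- The relation `x ∼_p y` for a complete `(τ, lam)`-closure type `p`: the transitive closure of the
relation `p ⊨ dist(x, y) ≤ 2 lam`. -/
def ClosureType.Sim {lam : ℕ} {X : Type} (B : BaseSeq V) (p : ClosureType (Sig.base V) lam X) :
    X → X → Prop :=
  Relation.TransGen fun x y => ∀ n a, p.Sat B n (B.str n) a →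
    DistLE (B.str n) (2 * lam) (a x) (a y)

/-- The `Y`-dimension of `p`: the number of `∼_p`-classes that are contained in `Y` and to which the
restriction of `p` is not bounded. -/
def ClosureType.dim {lam : ℕ} {X : Type} (B : BaseSeq V) (p : ClosureType (Sig.base V) lam X)
    (Y : Set X) : ℕ :=
  {E : Set X | (∃ x, E = {z | p.Sim B x z}) ∧ E ⊆ Y ∧
    ∃ q : ClosureType (Sig.base V) lam E, p.IsRestriction B Subtype.val q ∧
      ¬ ∃ m : ℕ, ∀ n, {a | q.Sat B n (B.str n) a}.ncard ≤ m}.ncard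

/-- An `(S, kap)`-basic formula `⋀_{i < k} (φ_i(x) → c_i)`, where `φ_i` is a complete
`(S, lam_i)`-closure type with `lam_i ≤ kap`; if `X` is empty then each `φ_i` is `⊤`. -/
structure BasicFormula (S : Sig V) (kap : ℕ) (X : Type) where
  k : ℕ
  lam : Fin k → ℕ
  lam_le : ∀ i, lam i ≤ kap
  c : Fin k → unitInterval
  φ : Nonempty X → ∀ i, ClosureType S (lam i) X

open Classical in
/-- The value of a basic formula; `⋀` is the minimum and `x → y` is `min(1, 1 - x + y)`. -/
def BasicFormula.eval {S : Sig V} {kap : ℕ} {X : Type} (χ : BasicFormula S kap X) (B : BaseSeq V)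
    (n : ℕ+) (A : Str S (B.dom n)) (a : X → B.dom n) : ℝ :=
  Finset.univ.fold min 1 fun i =>
    min 1 (1 - (if ∀ h : Nonempty X, (χ.φ h i).Sat B n A a then (1 : ℝ) else 0) + (χ.c i : ℝ))

/-! ## Networks -/

/-- A `PLA*(σ)`-network based on `τ`: a DAG on `σ \ τ` (`edge Q R` says that `Q` is a parent of `R`)
and a probability formula `θ_R ∈ PLA*(par(R) ∪ τ)` for every `R ∈ σ \ τ`. -/
structure Network (V : Signatures) where
  edge : {R : V.Sym // R ∉ V.tau} → {R : V.Sym // R ∉ V.tau} → Prop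
  acyclic : ∀ R, ¬ Relation.TransGen edge R R
  θ : ∀ R : {R : V.Sym // R ∉ V.tau},
    PLA (V := V) ⟨V.tau ∪ {Q | ∃ h : Q ∉ V.tau, edge ⟨Q, h⟩ R}, Set.subset_union_left⟩
      (V.arity R.1)

namespace Network

variable (G : Network V)

/-- The signature `τ ∪ par(R)`. -/
def parSig (R : {R : V.Sym // R ∉ V.tau}) : Sig V :=
  ⟨V.tau ∪ {Q | ∃ h : Q ∉ V.tau, G.edge ⟨Q, h⟩ R}, Set.subset_union_left⟩

/-- `S` contains the parents of all its members, so that it induces a subnetwork of `G`. -/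
def Closed (S : Sig V) : Prop :=
  ∀ R : {R : V.Sym // R ∉ V.tau}, R.1 ∈ S.carrier → (G.parSig R).carrier ⊆ S.carrier

/-- There is a directed path of length `m` that ends in `R`. -/
def HasPath (m : ℕ) (R : {R : V.Sym // R ∉ V.tau}) : Prop :=
  ∃ v : Fin (m + 1) → {R : V.Sym // R ∉ V.tau}, v (Fin.last m) = R ∧
    ∀ i : Fin m, G.edge (v i.castSucc) (v i.succ)

/-- `mp(R)`: the length of the longest directed path that ends in `R`. -/
def mp (R : {R : V.Sym // R ∉ V.tau}) : ℕ := sSup {m | G.HasPath m R}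

open Classical in
/-- The maximal path rank of `G`: the length of the longest directed path in `G`, and `-1` if the
DAG has no vertices. -/
def mpRank : ℤ :=
  if Nonempty {R : V.Sym // R ∉ V.tau} then ((sSup {m | ∃ R, G.HasPath m R} : ℕ) : ℤ) else -1

/-- `σ' = τ ∪ {R ∈ σ \ τ : mp(R) < ρ}` where `ρ` is the maximal path rank of `G`. -/
def sig' : Sig V :=
  ⟨{R | R ∈ V.tau ∨ ∃ h : R ∉ V.tau, (G.mp ⟨R, h⟩ : ℤ) < G.mpRank}, fun _ h => Or.inl h⟩

theorem hasPath_lt_card [Fintype {R : V.Sym // R ∉ V.tau}] {m : ℕ}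
    {R : {R : V.Sym // R ∉ V.tau}} (h : G.HasPath m R) :
    m < Fintype.card {R : V.Sym // R ∉ V.tau} := by
  obtain ⟨v, -, hv⟩ := h
  have key : ∀ i j : Fin (m + 1), i < j → Relation.TransGen G.edge (v i) (v j) := by
    intro i j
    induction j using Fin.induction with
    | zero => intro h; exact absurd h (Fin.not_lt_zero _)
    | succ j ih =>
      intro h
      rcases (Fin.le_castSucc_iff.mpr h).lt_or_eq with h | h
      · exact (ih h).tail (hv j)
      · rw [h]; exact .single (hv j)
  have inj : Function.Injective v := by
    intro i j hij
    rcases lt_trichotomy i j with h | h | h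
    · exact absurd (hij ▸ key i j h) (G.acyclic _)
    · exact h
    · exact absurd (hij ▸ key j i h) (G.acyclic _)
  have := Fintype.card_le_of_injective v inj
  rw [Fintype.card_fin] at this
  omega

theorem bddAbove_path : BddAbove {m | ∃ R, G.HasPath m R} := by
  classical
  exact ⟨Fintype.card {R : V.Sym // R ∉ V.tau}, fun _ ⟨_, h⟩ => (G.hasPath_lt_card h).le⟩

theorem mp_lt_mp {Q R : {R : V.Sym // R ∉ V.tau}} (h : G.edge Q R) : G.mp Q < G.mp R := by
  have hb : ∀ R, BddAbove {m | G.HasPath m R} := fun R =>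
    G.bddAbove_path.mono fun m hm => Exists.intro R hm
  have hne : {m | G.HasPath m Q}.Nonempty := ⟨0, by exact ⟨fun _ => Q, rfl, fun i => i.elim0⟩⟩
  obtain ⟨v, hv, hE⟩ : G.HasPath (G.mp Q) Q := Nat.sSup_mem hne (hb Q)
  refine Nat.lt_of_succ_le (le_csSup (hb R) ⟨Fin.snoc v R, by simp, fun i => ?_⟩)
  rw [Fin.snoc_castSucc]
  induction i using Fin.lastCases with
  | last => rw [Fin.succ_last, Fin.snoc_last, hv]; exact h
  | cast i => rw [Fin.succ_castSucc, Fin.snoc_castSucc]; exact hE i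

/-- The parents of every `R ∈ σ \ τ` belong to `σ'`. -/
theorem parSig_subset_sig' (R : {R : V.Sym // R ∉ V.tau}) :
    (G.parSig R).carrier ⊆ G.sig'.carrier := by
  rintro Q (hQ | ⟨hQ, h⟩)
  · exact Or.inl hQ
  · refine Or.inr ⟨hQ, ?_⟩
    have hne : {m | G.HasPath m R}.Nonempty := ⟨0, by exact ⟨fun _ => R, rfl, fun i => i.elim0⟩⟩
    have hb : BddAbove {m | G.HasPath m R} := G.bddAbove_path.mono fun m hm => Exists.intro R hm
    have h1 : G.mp R ≤ sSup {m | ∃ R, G.HasPath m R} :=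
      le_csSup G.bddAbove_path ⟨R, Nat.sSup_mem hne hb⟩
    have h2 := G.mp_lt_mp h
    rw [mpRank, if_pos ⟨R⟩]
    exact_mod_cast h2.trans_le h1

theorem closed_sig' : G.Closed G.sig' := fun R _ => G.parSig_subset_sig' R

theorem closed_full : G.Closed (Sig.full V) := fun _ _ => Set.subset_univ _

/-! ## The induced probability distributions -/

open Classical in
/-- The weight of a structure `A` under the distribution induced by the subnetwork of `G` with
signature `S`: given the relations of lower rank, the events `R(a)` are independent, and `R(a)` has
probability `A(θ_R(a))`, which depends only on the reduct of `A` to `τ ∪ par(R)`. -/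
def weight {S : Sig V} (hS : G.Closed S) {D : Type} [Fintype D] (A : Str S D) : ℝ :=
  ∏ R : {R : {R : V.Sym // R ∉ V.tau} // R.1 ∈ S.carrier},
    ∏ a : Fin (V.arity R.1.1) → D,
      if A ⟨R.1.1, R.2⟩ a then
        (((G.θ R.1).eval (reduct (S := G.parSig R.1) (hS R.1 R.2) A) a : unitInterval) : ℝ)
      else
        1 - (((G.θ R.1).eval (reduct (S := G.parSig R.1) (hS R.1 R.2) A) a : unitInterval) : ℝ)

open Classical in
/-- The probability `P_n(E)` of an event `E ⊆ W_n`, for the distribution on the expansions of `B_n`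
to `S` which is induced by the subnetwork of `G` with signature `S`. -/
def prob {S : Sig V} (hS : G.Closed S) (B : BaseSeq V) (n : ℕ+) (E : B.W S n → Prop) : ℝ :=
  ∑ A : B.W S n, if E A then G.weight hS A.1 else 0

/-- `(φ, ψ)` converges to `α`: for all `ε > 0`, all sufficiently large `n` and all tuples `a`, if
`P_n(ψ(a)) > 0` then `P_n(φ(a) | ψ(a)) ∈ [α - ε, α + ε]`. -/
def ConvergesTo {S : Sig V} (hS : G.Closed S) (B : BaseSeq V) {X : Type} (φ ψ : Query B S X)
    (α : ℝ) : Prop :=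
  ∀ ε > (0 : ℝ), ∃ n₀ : ℕ+, ∀ n ≥ n₀, ∀ a : X → B.dom n,
    0 < G.prob hS B n (fun A => ψ n A a) →
      G.prob hS B n (fun A => φ n A a ∧ ψ n A a) / G.prob hS B n (fun A => ψ n A a)
        ∈ Set.Icc (α - ε) (α + ε)

/-- `(φ, ψ)` converges. -/
def Converges {S : Sig V} (hS : G.Closed S) (B : BaseSeq V) {X : Type} (φ ψ : Query B S X) :
    Prop :=
  ∃ α ∈ Set.Icc (0 : ℝ) 1, G.ConvergesTo hS B φ ψ α

/-- The triple `(φ(x, y), ψ(x, y), χ(x))` is balanced: for some `α ∈ [0,1]` and all `ε > 0`, the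
probability that it is `(α, ε)`-balanced in `A ∈ W_n` tends to `1`. -/
def Balanced {S : Sig V} (hS : G.Closed S) (B : BaseSeq V) {X Y : Type}
    (φ ψ : Query B S (X ⊕ Y)) (χ : Query B S X) : Prop :=
  ∃ α ∈ Set.Icc (0 : ℝ) 1, ∀ ε > (0 : ℝ),
    Filter.Tendsto (fun n => G.prob hS B n fun A => ∀ a : X → B.dom n, χ n A a →
        (α - ε) * ({b : Y → B.dom n | ψ n A (Sum.elim a b)}.ncard : ℝ)
            ≤ ({b : Y → B.dom n | φ n A (Sum.elim a b) ∧ ψ n A (Sum.elim a b)}.ncard : ℝ) ∧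
        ({b : Y → B.dom n | φ n A (Sum.elim a b) ∧ ψ n A (Sum.elim a b)}.ncard : ℝ)
            ≤ (α + ε) * ({b : Y → B.dom n | ψ n A (Sum.elim a b)}.ncard : ℝ))
      Filter.atTop (nhds 1)

/-- The induction hypothesis, for `σ'`, the subnetwork `G'` of `G` induced by `σ'`, and the numbers
`kap`, `kap'`. -/
structure InductionHypothesis (B : BaseSeq V) (kap kap' : ℕ) : Prop where
  /-- Every probability formula `θ_R` is asymptotically equivalent, with respect to the distributions
  induced by `G'`, to a `(σ', kap)`-basic formula. -/
  elimination : ∀ R : {R : V.Sym // R ∉ V.tau},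
    ∃ χ : BasicFormula G.sig' kap (Fin (V.arity R.1)), ∀ ε > (0 : ℝ),
      Filter.Tendsto (fun n => G.prob G.closed_sig' B n fun A => ∃ a : Fin (V.arity R.1) → B.dom n,
          ε < |(((G.θ R).eval (reduct (S := G.parSig R) (G.parSig_subset_sig' R) A.1) a :
            unitInterval) : ℝ) - χ.eval B n A.1 a|)
        Filter.atTop (nhds 0)
  convergence : ∀ (lam gam : ℕ), kap' ≤ gam → ∀ (X : Type) [Finite X]
    (p' : ClosureType G.sig' lam X) (pτ : ClosureType (Sig.base V) (lam + gam) X),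
    G.Converges G.closed_sig' B (p'.toQuery B G.sig' subset_rfl)
      (pτ.toQuery B G.sig' G.sig'.tau_subset)
  balance : ∀ (lam gam : ℕ), kap' ≤ gam → ∀ (X Y : Type) [Finite X] [Finite Y]
    (p' : ClosureType G.sig' lam (X ⊕ Y)) (pτ : ClosureType (Sig.base V) (lam + gam) (X ⊕ Y))
    (q' : ClosureType G.sig' lam X),
    pτ.StronglyUnbounded B → pτ.dim B (Set.range Sum.inr) = 1 →
    G.Balanced G.closed_sig' B (p'.toQuery B G.sig' subset_rfl)
      (pτ.toQuery B G.sig' G.sig'.tau_subset) (q'.toQuery B G.sig' subset_rfl)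

end Network

end PLANet

end

/-!
Given an expansion of `B_n` to `σ'`, the atoms of the remaining symbols are independent, because all
their parents belong to `σ'`; hence the probability of `p(a)` is the mean, over the expansions `A`
to `σ'`, of the conditional probability of `p(a)` given `A` (`Network.prob_eq_sum_bern`).

Whether `p(a)` holds depends only on the `lam`-closure of `a`, which consists of the points at
distance at most `lam` from `a` or from a `lam`-rare element. If `a` realizes `pτ`, then the size of
this closure is bounded, so that the conditional probability depends on the probabilities `θ_R(b)`
of boundedly many atoms, in a uniformly continuous way (`abs_bern_sat_sub_le`). By the induction
hypothesis one may therefore replace `θ_R` by a basic formula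
(`Network.tendsto_prob_sub_sum_bern`). The value of the latter at a tuple `b` in the `lam`-closure
of `a` is determined by the closure types of `b` of radius at most `kap`, and these are determined
by the closure type of `a` of radius `lam + kap` (`ClosureIso.restrict`): rarity is monotone in the
radius, and an isomorphism between closures preserves the balls inside of them. So, after the
replacement, the conditional probability is a constant `c_t` on each closure type `t` of radius
`lam + kap` over `σ'` (`Network.bern_basicProb_eq`).

Only finitely many types `t` occur in expansions of realizations of `pτ`, since `t` can be read off
from the diagram of the finitely many elements which `pτ` lists (`exists_finite_closureTypes`). Thus
the probability of `p(a)` is asymptotic to the finite sum of the numbers `c_t P'_n(t(a))`, and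
`P'_n(t(a))` converges by the induction hypothesis, as `pτ` has radius `(lam + kap) + gam`.
Conditioning on `pτ(a)` is harmless because the truth of `pτ(a)` is the same in all expansions.
-/

noncomputable section

namespace PLANet

variable {V : Signatures}

/-! ### Distances and partial isomorphisms -/

theorem DistLE.refl {S : Sig V} {D : Type} (A : Str S D) (j : ℕ) (a : D) : DistLE A j a a := by
  simp [DistLE]

theorem DistLE.mono {S : Sig V} {D : Type} {A : Str S D} {i j : ℕ} (h : i ≤ j) {a b : D}
    (hab : DistLE A i a b) : DistLE A j a b :=
  le_trans hab (by exact_mod_cast h)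

theorem DistLE.trans {S : Sig V} {D : Type} {A : Str S D} {i j : ℕ} {a b c : D}
    (hab : DistLE A i a b) (hbc : DistLE A j b c) : DistLE A (i + j) a c := by
  refine le_trans (gaifman A).edist_triangle (le_trans (add_le_add hab hbc) ?_)
  push_cast
  exact le_rfl

theorem distLE_of_adj {S : Sig V} {D : Type} {A : Str S D} {a b : D} (h : (gaifman A).Adj a b) :
    DistLE A 1 a b := by
  have := SimpleGraph.edist_eq_one_iff_adj.mpr h
  simp [DistLE, this]

theorem distLE_zero {S : Sig V} {D : Type} {A : Str S D} {a b : D} : DistLE A 0 a b ↔ a = b := by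
  simp [DistLE]

theorem DistLE.succ_cases {S : Sig V} {D : Type} {A : Str S D} {j : ℕ} {a b : D}
    (h : DistLE A (j + 1) a b) :
    DistLE A j a b ∨ ∃ u, (gaifman A).Adj a u ∧ DistLE A j u b := by
  have hr : (gaifman A).Reachable a b :=
    SimpleGraph.reachable_of_edist_ne_top fun h' => by
      rw [DistLE, h'] at h
      exact absurd (top_le_iff.mp h) (ENat.natCast_ne_top _)
  obtain ⟨w, hw⟩ := hr.exists_walk_length_eq_edist
  rw [DistLE, ← hw, Nat.cast_le] at h
  cases w with
  | nil => exact .inl (.refl A j _)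
  | cons hadj q =>
    refine .inr ⟨_, hadj, (SimpleGraph.edist_le q).trans ?_⟩
    rw [SimpleGraph.Walk.length_cons] at h
    exact_mod_cast Nat.le_of_succ_le_succ h

/-- The relation `r` is the graph of an isomorphism between the substructures which `A₁` and `A₂`
induce on its domain and its range. -/
structure PartialIso {S : Sig V} {D₁ D₂ : Type} (A₁ : Str S D₁) (A₂ : Str S D₂)
    (r : D₁ → D₂ → Prop) : Prop where
  eq_iff : ∀ {c c' d d'}, r c d → r c' d' → (c = c' ↔ d = d')
  rel_iff : ∀ R v w, (∀ i, r (v i) (w i)) → (A₁ R v ↔ A₂ R w)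

namespace PartialIso

variable {S : Sig V} {D₁ D₂ : Type} {A₁ : Str S D₁} {A₂ : Str S D₂} {r : D₁ → D₂ → Prop}

theorem symm (h : PartialIso A₁ A₂ r) : PartialIso A₂ A₁ (flip r) :=
  ⟨fun hc hd => (h.eq_iff hc hd).symm, fun R v w hvw => (h.rel_iff R w v hvw).symm⟩

theorem reduct {T : Sig V} (hT : T.carrier ⊆ S.carrier) (h : PartialIso A₁ A₂ r) :
    PartialIso (PLANet.reduct hT A₁) (PLANet.reduct hT A₂) r :=
  ⟨h.eq_iff, fun R v w hvw => h.rel_iff ⟨R, hT R.2⟩ v w hvw⟩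

/-- If a ball around `c` lies in the domain, then distances from `c` within this ball do not
increase: the tuples that witness the edges of a path which starts in `c` lie in the ball too. -/
theorem distLE (h : PartialIso A₁ A₂ r) {c : D₁} {d : D₂} (hcd : r c d) (j : ℕ)
    (hball : ∀ z, DistLE A₁ j z c → ∃ w, r z w) {z : D₁} {w : D₂} (hzw : r z w)
    (hz : DistLE A₁ j z c) : DistLE A₂ j w d := by
  induction j generalizing z w with
  | zero => exact distLE_zero.mpr ((h.eq_iff hzw hcd).mp (distLE_zero.mp hz))
  | succ j ih =>
    have hball' : ∀ z, DistLE A₁ j z c → ∃ w, r z w := fun z hz =>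
      hball z (hz.mono j.le_succ)
    rcases hz.succ_cases with hz | ⟨u, hadj, hu⟩
    · exact (ih hball' hzw hz).mono j.le_succ
    · obtain ⟨u', huu'⟩ := hball' u hu
      obtain ⟨hne, R, hR, t, ht, ⟨i, hi⟩, ⟨k, hk⟩⟩ := hadj
      have hdom : ∀ l, ∃ w, r (t l) w := by
        intro l
        refine hball _ ?_
        by_cases hl : t l = u
        · exact hl ▸ hu.mono j.le_succ
        · rw [add_comm]
          exact (distLE_of_adj ⟨hl, R, hR, t, ht, ⟨l, rfl⟩, ⟨k, hk⟩⟩).trans hu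
      choose t' ht' using hdom
      have h2 : (gaifman A₂).Adj w u' := by
        refine ⟨fun he => hne ((h.eq_iff hzw huu').mpr he), R, hR, t',
          (h.rel_iff ⟨R, S.tau_subset hR⟩ t t' ht').mp ht, ⟨i, ?_⟩, ⟨k, ?_⟩⟩
        · exact (h.eq_iff (ht' i) hzw).mp hi
        · exact (h.eq_iff (ht' k) huu').mp hk
      rw [add_comm]
      exact (distLE_of_adj h2).trans (ih hball' huu' hu)

end PartialIso

/-! ### Diagrams and neighbourhood types along partial isomorphisms -/

/-- The diagram of a tuple `e` in `A`. -/
def Diagram.of {S : Sig V} {Z D : Type} (A : Str S D) (e : Z → D) : Diagram S Z :=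
  ⟨fun x y => e x = e y, fun R v => A R (e ∘ v)⟩

theorem Diagram.sat_of {S : Sig V} {Z D : Type} (A : Str S D) (e : Z → D) :
    (Diagram.of A e).Sat A e :=
  ⟨fun _ _ => Iff.rfl, fun _ _ => Iff.rfl⟩

instance {S : Sig V} {Z : Type} [Finite Z] : Finite (Diagram S Z) := by
  have : Function.Injective fun p : Diagram S Z => (p.eq, p.rel) := by
    rintro ⟨e, r⟩ ⟨e', r'⟩ h
    simp only [Prod.mk.injEq] at h
    rw [h.1, h.2]
  exact Finite.of_injective _ this

theorem Diagram.Sat.partialIso {S : Sig V} {Z D₁ D₂ : Type} {p : Diagram S Z} {A₁ : Str S D₁}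
    {A₂ : Str S D₂} {e₁ : Z → D₁} {e₂ : Z → D₂} (h₁ : p.Sat A₁ e₁) (h₂ : p.Sat A₂ e₂) :
    PartialIso A₁ A₂ fun c d => ∃ z, e₁ z = c ∧ e₂ z = d := by
  constructor
  · rintro _ _ _ _ ⟨z, rfl, rfl⟩ ⟨z', rfl, rfl⟩
    exact (h₁.1 z z').trans (h₂.1 z z').symm
  · intro R v w hvw
    choose u hu using hvw
    obtain rfl : e₁ ∘ u = v := funext fun i => (hu i).1
    obtain rfl : e₂ ∘ u = w := funext fun i => (hu i).2
    exact (h₁.2 R u).trans (h₂.2 R u).symm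

theorem PartialIso.diagram_sat {S : Sig V} {Z D₁ D₂ : Type} {p : Diagram S Z} {A₁ : Str S D₁}
    {A₂ : Str S D₂} {r : D₁ → D₂ → Prop} (h : PartialIso A₁ A₂ r) {e₁ : Z → D₁} {e₂ : Z → D₂}
    (he : ∀ z, r (e₁ z) (e₂ z)) (h₁ : p.Sat A₁ e₁) : p.Sat A₂ e₂ :=
  ⟨fun x y => (h.eq_iff (he x) (he y)).symm.trans (h₁.1 x y),
    fun R v => (h.rel_iff R _ _ fun i => he (v i)).symm.trans (h₁.2 R v)⟩

/-- A partial isomorphism whose domain and range contain the relevant balls preserves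
neighbourhood types. -/
theorem PartialIso.nbhd_sat {S : Sig V} {X D₁ D₂ : Type} {j : ℕ} {p : NbhdType S j X}
    {A₁ : Str S D₁} {A₂ : Str S D₂} {r : D₁ → D₂ → Prop} (h : PartialIso A₁ A₂ r)
    {b₁ : X → D₁} {b₂ : X → D₂} (hb : ∀ x, r (b₁ x) (b₂ x))
    (hdom : ∀ z x, DistLE A₁ j z (b₁ x) → ∃ w, r z w)
    (hran : ∀ w x, DistLE A₂ j w (b₂ x) → ∃ z, r z w) (hp : p.Sat A₁ b₁) : p.Sat A₂ b₂ := by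
  obtain ⟨y, hy, hcover, hdiag⟩ := hp
  have : ∀ i, ∃ w, r (y i) w := fun i => let ⟨x, hx⟩ := hy i; hdom _ x hx
  choose y' hy' using this
  refine ⟨y', fun i => ?_, ?_, h.diagram_sat ?_ hdiag⟩
  · obtain ⟨x, hx⟩ := hy i
    exact ⟨x, h.distLE (hb x) j (fun z hz => hdom z x hz) (hy' i) hx⟩
  · rintro w ⟨x, hx⟩
    obtain ⟨z, hzw⟩ := hran w x hx
    obtain ⟨i, rfl⟩ := hcover z ⟨x, h.symm.distLE (hb x) j (fun w hw => hran w x hw) hzw hx⟩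
    exact ⟨i, (h.eq_iff hzw (hy' i)).mp rfl⟩
  · rintro (x | i)
    · exact hb x
    · exact hy' i

/-- Every tuple in a finite structure satisfies a complete neighbourhood type. -/
theorem exists_nbhdType_sat {S : Sig V} {X D : Type} [Finite D] (j : ℕ) (A : Str S D) (a : X → D) :
    ∃ p : NbhdType S j X, p.Sat A a := by
  let e := Finite.equivFin {z // ∃ x, DistLE A j z (a x)}
  let y : Fin _ → D := fun i => (e.symm i).1
  have hsat : NbhdSat j (Diagram.of A (Sum.elim a y)) A a :=
    ⟨y, fun i => (e.symm i).2, fun z hz => ⟨e ⟨z, hz⟩, by simp [y]⟩, Diagram.sat_of _ _⟩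
  exact ⟨⟨_, _, D, inferInstance, A, a, hsat⟩, hsat⟩

/-- Two tuples of the same neighbourhood type are related by an isomorphism between their
neighbourhoods. -/
theorem NbhdType.Sat.exists_partialIso {S : Sig V} {X D₁ D₂ : Type} {j : ℕ} {p : NbhdType S j X}
    {A₁ : Str S D₁} {A₂ : Str S D₂} {b₁ : X → D₁} {b₂ : X → D₂} (h₁ : p.Sat A₁ b₁)
    (h₂ : p.Sat A₂ b₂) : ∃ r, PartialIso A₁ A₂ r ∧ (∀ x, r (b₁ x) (b₂ x)) ∧
      (∀ z, (∃ x, DistLE A₁ j z (b₁ x)) → ∃ w, r z w ∧ ∃ x, DistLE A₂ j w (b₂ x)) ∧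
      (∀ w, (∃ x, DistLE A₂ j w (b₂ x)) → ∃ z, r z w ∧ ∃ x, DistLE A₁ j z (b₁ x)) := by
  obtain ⟨y₁, hy₁, hc₁, hd₁⟩ := h₁
  obtain ⟨y₂, hy₂, hc₂, hd₂⟩ := h₂
  refine ⟨_, hd₁.partialIso hd₂, fun x => ⟨.inl x, rfl, rfl⟩, fun z hz => ?_, fun w hw => ?_⟩
  · obtain ⟨i, rfl⟩ := hc₁ z hz
    exact ⟨y₂ i, ⟨.inr i, rfl, rfl⟩, hy₂ i⟩
  · obtain ⟨i, rfl⟩ := hc₂ w hw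
    exact ⟨y₁ i, ⟨.inr i, rfl, rfl⟩, hy₁ i⟩

/-! ### Rare elements -/

namespace BaseSeq

variable {B : BaseSeq V}

/-- Rarity is monotone in the radius: the type of larger radius of a rare element implies its
bounded type of smaller radius. -/
theorem Rare.mono {i j : ℕ} (hij : i ≤ j) {n : ℕ+} {c : B.dom n} (h : B.Rare i n c) :
    B.Rare j n c := by
  obtain ⟨p, ⟨m, hm⟩, hp⟩ := h
  obtain ⟨q, hq⟩ := exists_nbhdType_sat j (B.str n) fun _ : Fin 1 => c
  refine ⟨q, ⟨m, fun n' => le_trans (Set.ncard_le_ncard ?_ (Set.toFinite _)) (hm n')⟩, hq⟩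
  intro a ha
  obtain ⟨r, hr, hb, hdom, hran⟩ := hq.exists_partialIso ha
  refine hr.nbhd_sat hb (fun z x hz => ?_) (fun w x hw => ?_) hp
  · obtain ⟨w, hw, -⟩ := hdom z ⟨x, hz.mono hij⟩
    exact ⟨w, hw⟩
  · obtain ⟨z, hz, -⟩ := hran w ⟨x, hw.mono hij⟩
    exact ⟨z, hz⟩

/-- `w` is an entry of the tuple `a` or an `m`-rare element. -/
def Center (B : BaseSeq V) (m : ℕ) {n : ℕ+} {X : Type} (a : X → B.dom n) (w : B.dom n) : Prop :=
  (∃ x, w = a x) ∨ B.Rare m n w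

/-- `c` belongs to the `m`-closure of the tuple `a`: its distance to an entry of `a` or to an
`m`-rare element is at most `m`. -/
def InClosure (B : BaseSeq V) (m : ℕ) {n : ℕ+} {X : Type} (a : X → B.dom n) (c : B.dom n) : Prop :=
  ∃ w, B.Center m a w ∧ DistLE (B.str n) m c w

theorem Center.mono {i j : ℕ} (hij : i ≤ j) {n : ℕ+} {X : Type} {a : X → B.dom n} {w : B.dom n}
    (h : B.Center i a w) : B.Center j a w :=
  h.imp id (Rare.mono hij)

theorem Center.inClosure {m : ℕ} {n : ℕ+} {X : Type} {a : X → B.dom n} {w : B.dom n}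
    (h : B.Center m a w) : B.InClosure m a w :=
  ⟨w, h, .refl _ _ _⟩

theorem W.distLE_iff {S : Sig V} {n : ℕ+} (A : B.W S n) {j : ℕ} {a b : B.dom n} :
    DistLE A.1 j a b ↔ DistLE (B.str n) j a b := by
  have : gaifman A.1 = gaifman (B.str n) := by
    conv_rhs => rw [← A.2]
    rfl
  rw [DistLE, DistLE, this]

end BaseSeq

/-! ### Isomorphisms between closures -/

/-- The relation `r` is an isomorphism between the `m`-closure of `a₁` in `A₁` and the `m`-closure
of `a₂` in `A₂` which maps `a₁` to `a₂` and preserves rarity. (The relation may also relate some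
elements outside of the closures.) -/
structure ClosureIso (B : BaseSeq V) {S : Sig V} (m : ℕ) {n₁ n₂ : ℕ+} (A₁ : B.W S n₁)
    (A₂ : B.W S n₂) {X : Type} (a₁ : X → B.dom n₁) (a₂ : X → B.dom n₂)
    (r : B.dom n₁ → B.dom n₂ → Prop) : Prop where
  iso : PartialIso A₁.1 A₂.1 r
  tuple : ∀ x, r (a₁ x) (a₂ x)
  rare : ∀ c d, r c d → (B.Rare m n₁ c ↔ B.Rare m n₂ d)
  dom : ∀ c, B.InClosure m a₁ c → ∃ d, r c d ∧ B.InClosure m a₂ d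
  ran : ∀ d, B.InClosure m a₂ d → ∃ c, r c d ∧ B.InClosure m a₁ c

namespace ClosureIso

variable {B : BaseSeq V} {S : Sig V} {m : ℕ} {n₁ n₂ : ℕ+} {A₁ : B.W S n₁} {A₂ : B.W S n₂} {X : Type}
  {a₁ : X → B.dom n₁} {a₂ : X → B.dom n₂} {r : B.dom n₁ → B.dom n₂ → Prop}

theorem symm (h : ClosureIso B m A₁ A₂ a₁ a₂ r) : ClosureIso B m A₂ A₁ a₂ a₁ (flip r) :=
  ⟨h.iso.symm, h.tuple, fun c d hcd => (h.rare d c hcd).symm, h.ran, h.dom⟩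

theorem iso_base (h : ClosureIso B m A₁ A₂ a₁ a₂ r) : PartialIso (B.str n₁) (B.str n₂) r := by
  have := h.iso.reduct (T := Sig.base V) S.tau_subset
  rwa [A₁.2, A₂.2] at this

/-- The balls of radius `j` around points at distance at most `m - j` from a centre lie in the
domain. -/
theorem dom_of_center (h : ClosureIso B m A₁ A₂ a₁ a₂ r) {i j : ℕ} (hij : i + j ≤ m)
    {b w z : B.dom n₁} (hw : B.Center m a₁ w) (hb : DistLE (B.str n₁) i b w)
    (hz : DistLE (B.str n₁) j z b) : ∃ d, r z d := by
  obtain ⟨d, hd, -⟩ := h.dom z ⟨w, hw, (hz.trans hb).mono (by omega)⟩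
  exact ⟨d, hd⟩

/-- Rarity of a smaller radius is preserved too: the ball which decides it lies in the closure. -/
theorem rare_of_rare (h : ClosureIso B m A₁ A₂ a₁ a₂ r) {j : ℕ} (hj : j ≤ m) {c : B.dom n₁}
    {d : B.dom n₂} (hcd : r c d) (hc : B.Rare j n₁ c) : B.Rare j n₂ d := by
  have hcm := hc.mono hj
  have hdm := (h.rare c d hcd).mp hcm
  obtain ⟨p, hbd, hp⟩ := hc
  refine ⟨p, hbd, h.iso_base.nbhd_sat (fun _ => hcd) (fun z _ hz => ?_) (fun w _ hw => ?_) hp⟩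
  · exact h.dom_of_center (i := 0) (by omega) (.inr hcm) (.refl _ _ _) hz
  · exact h.symm.dom_of_center (i := 0) (by omega) (.inr hdm) (.refl _ _ _) hw

theorem center_image (h : ClosureIso B m A₁ A₂ a₁ a₂ r) {w : B.dom n₁} (hw : B.Center m a₁ w) :
    ∃ w', r w w' ∧ B.Center m a₂ w' := by
  rcases hw with ⟨x, rfl⟩ | hw
  · exact ⟨a₂ x, h.tuple x, .inl ⟨x, rfl⟩⟩
  · obtain ⟨w', hw', -⟩ := h.dom w (BaseSeq.Center.inClosure (.inr hw))
    exact ⟨w', hw', .inr ((h.rare w w' hw').mp hw)⟩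

theorem dom_of_near (h : ClosureIso B m A₁ A₂ a₁ a₂ r) {i j : ℕ} (hij : i + j ≤ m) {Y : Type}
    {b₁ : Y → B.dom n₁} {b₂ : Y → B.dom n₂} (hb : ∀ y, r (b₁ y) (b₂ y))
    (hnear : ∀ y, ∃ w, B.Center m a₁ w ∧ DistLE (B.str n₁) i (b₁ y) w) (c : B.dom n₁)
    (hc : B.InClosure j b₁ c) : ∃ d, r c d ∧ B.InClosure j b₂ d := by
  obtain ⟨w, ⟨y, rfl⟩ | hw, hcw⟩ := hc
  · obtain ⟨u, hu, hyu⟩ := hnear y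
    obtain ⟨d, hd⟩ := h.dom_of_center hij hu hyu hcw
    exact ⟨d, hd, b₂ y, .inl ⟨y, rfl⟩, h.iso_base.distLE (hb y) j
      (fun z hz => h.dom_of_center hij hu hyu hz) hd hcw⟩
  · have hwm : B.Center m a₁ w := .inr (hw.mono (by omega))
    have hball : ∀ z, DistLE (B.str n₁) j z w → ∃ d, r z d := fun z hz =>
      h.dom_of_center (i := 0) (by omega) hwm (.refl _ _ _) hz
    obtain ⟨d, hd⟩ := hball c hcw
    obtain ⟨w', hw', -⟩ := h.center_image hwm
    exact ⟨d, hd, w', .inr (h.rare_of_rare (by omega) hw' hw), h.iso_base.distLE hw' j hball hd hcw⟩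

/-- An isomorphism between `m`-closures restricts to the `j`-closures of tuples whose distance to
the centres is at most `m - j`. -/
theorem restrict (h : ClosureIso B m A₁ A₂ a₁ a₂ r) {i j : ℕ} (hij : i + j ≤ m) {Y : Type}
    {b₁ : Y → B.dom n₁} {b₂ : Y → B.dom n₂} (hb : ∀ y, r (b₁ y) (b₂ y))
    (hnear : ∀ y, ∃ w, B.Center m a₁ w ∧ DistLE (B.str n₁) i (b₁ y) w) :
    ClosureIso B j A₁ A₂ b₁ b₂ r := by
  refine ⟨h.iso, hb, fun c d hcd => ⟨h.rare_of_rare (by omega) hcd,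
    h.symm.rare_of_rare (by omega) hcd⟩, h.dom_of_near hij hb hnear,
    h.symm.dom_of_near hij hb fun y => ?_⟩
  obtain ⟨w, hw, hyw⟩ := hnear y
  obtain ⟨w', hww', hw'⟩ := h.center_image hw
  exact ⟨w', hw', h.iso_base.distLE hww' i (fun z hz =>
    h.dom_of_center (i := 0) (by omega) hw (.refl _ _ _) hz) (hb y) hyw⟩

theorem mono (h : ClosureIso B m A₁ A₂ a₁ a₂ r) {j : ℕ} (hj : j ≤ m) :
    ClosureIso B j A₁ A₂ a₁ a₂ r :=
  h.restrict (i := 0) (by omega) h.tuple fun y => ⟨a₁ y, .inl ⟨y, rfl⟩, .refl _ _ _⟩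

theorem sat (h : ClosureIso B m A₁ A₂ a₁ a₂ r) {p : ClosureType S m X}
    (hp : p.Sat B n₁ A₁.1 a₁) : p.Sat B n₂ A₂.1 a₂ := by
  obtain ⟨y, hy, hcover, hsat⟩ := hp
  have : ∀ i, ∃ d, r (y i) d := fun i =>
    let ⟨d, hd, _⟩ := h.dom _ (BaseSeq.Center.inClosure (.inr (hy i)))
    ⟨d, hd⟩
  choose y' hy' using this
  refine ⟨y', fun i => (h.rare _ _ (hy' i)).mp (hy i), fun u hu => ?_, ?_⟩
  · obtain ⟨c, hc, -⟩ := h.ran u (BaseSeq.Center.inClosure (.inr hu))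
    obtain ⟨i, rfl⟩ := hcover c ((h.rare _ _ hc).mpr hu)
    exact ⟨i, (h.iso.eq_iff hc (hy' i)).mp rfl⟩
  · have hcen₁ : ∀ x, B.Center m a₁ (Sum.elim a₁ y x) := by
      rintro (x | i)
      exacts [.inl ⟨x, rfl⟩, .inr (hy i)]
    have hr : ∀ x, r (Sum.elim a₁ y x) (Sum.elim a₂ y' x) := by
      rintro (x | i)
      exacts [h.tuple x, hy' i]
    refine h.iso.nbhd_sat hr (fun z x hz => ?_) (fun w x hw => ?_) hsat
    · exact h.dom_of_center (i := 0) (by omega) (hcen₁ x) (.refl _ _ _) (A₁.distLE_iff.mp hz)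
    · have hcen₂ : B.Center m a₂ (Sum.elim a₂ y' x) := by
        rcases x with x | i
        exacts [.inl ⟨x, rfl⟩, .inr ((h.rare _ _ (hy' i)).mp (hy i))]
      exact h.symm.dom_of_center (i := 0) (by omega) hcen₂ (.refl _ _ _) (A₂.distLE_iff.mp hw)

theorem sat_iff (h : ClosureIso B m A₁ A₂ a₁ a₂ r) (p : ClosureType S m X) :
    p.Sat B n₁ A₁.1 a₁ ↔ p.Sat B n₂ A₂.1 a₂ :=
  ⟨h.sat, h.symm.sat⟩

end ClosureIso

/-! ### Closure types and their realizations -/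

/-- The tuple `e`, indexed by `(X ⊕ Fin k) ⊕ Fin l`, extends `a` by an enumeration of the `m`-rare
elements followed by an enumeration of the `m`-closure of `a`. -/
structure EnumeratesClosure (B : BaseSeq V) (m : ℕ) {n : ℕ+} {X : Type} {k l : ℕ}
    (a : X → B.dom n) (e : (X ⊕ Fin k) ⊕ Fin l → B.dom n) : Prop where
  tuple : ∀ x, e (.inl (.inl x)) = a x
  rare_iff : ∀ c, B.Rare m n c ↔ ∃ i, e (.inl (.inr i)) = c
  inClosure_iff : ∀ c, B.InClosure m a c ↔ ∃ i, e (.inr i) = c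

theorem EnumeratesClosure.closureIso {B : BaseSeq V} {S : Sig V} {m : ℕ} {n₁ n₂ : ℕ+} {X : Type}
    {k l : ℕ} {a₁ : X → B.dom n₁} {a₂ : X → B.dom n₂} {e₁ : (X ⊕ Fin k) ⊕ Fin l → B.dom n₁}
    {e₂ : (X ⊕ Fin k) ⊕ Fin l → B.dom n₂} (h₁ : EnumeratesClosure B m a₁ e₁)
    (h₂ : EnumeratesClosure B m a₂ e₂) {A₁ : B.W S n₁} {A₂ : B.W S n₂}
    {p : Diagram S ((X ⊕ Fin k) ⊕ Fin l)} (hp₁ : p.Sat A₁.1 e₁) (hp₂ : p.Sat A₂.1 e₂) :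
    ClosureIso B m A₁ A₂ a₁ a₂ fun c d => ∃ z, e₁ z = c ∧ e₂ z = d := by
  have hiso := hp₁.partialIso hp₂
  refine ⟨hiso, fun x => ⟨_, h₁.tuple x, h₂.tuple x⟩, ?_, ?_, ?_⟩
  · intro c d hcd
    rw [h₁.rare_iff, h₂.rare_iff]
    exact exists_congr fun i => hiso.eq_iff ⟨_, rfl, rfl⟩ hcd
  · intro c hc
    obtain ⟨i, rfl⟩ := (h₁.inClosure_iff c).mp hc
    exact ⟨_, ⟨_, rfl, rfl⟩, (h₂.inClosure_iff _).mpr ⟨i, rfl⟩⟩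
  · intro d hd
    obtain ⟨i, rfl⟩ := (h₂.inClosure_iff d).mp hd
    exact ⟨_, ⟨_, rfl, rfl⟩, (h₁.inClosure_iff _).mpr ⟨i, rfl⟩⟩

theorem ClosureType.Sat.exists_enumeration {B : BaseSeq V} {S : Sig V} {m : ℕ} {n : ℕ+} {X : Type}
    {p : ClosureType S m X} {A : B.W S n} {a : X → B.dom n} (h : p.Sat B n A.1 a) :
    ∃ e, EnumeratesClosure B m a e ∧ p.nbhd.diagram.Sat A.1 e := by
  obtain ⟨y, hy, hcover, z, hz, hzcover, hdiag⟩ := h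
  refine ⟨_, ⟨fun _ => rfl, fun c => ⟨fun hc => ?_, ?_⟩, fun c => ⟨?_, ?_⟩⟩, hdiag⟩
  · obtain ⟨i, rfl⟩ := hcover c hc
    exact ⟨i, rfl⟩
  · rintro ⟨i, rfl⟩
    exact hy i
  · rintro ⟨w, ⟨x, rfl⟩ | hw, hcw⟩
    · obtain ⟨i, rfl⟩ := hzcover c ⟨.inl x, A.distLE_iff.mpr hcw⟩
      exact ⟨i, rfl⟩
    · obtain ⟨k, rfl⟩ := hcover w hw
      obtain ⟨i, rfl⟩ := hzcover c ⟨.inr k, A.distLE_iff.mpr hcw⟩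
      exact ⟨i, rfl⟩
  · rintro ⟨i, rfl⟩
    obtain ⟨x | k, hx⟩ := hz i
    · exact ⟨a x, .inl ⟨x, rfl⟩, A.distLE_iff.mp hx⟩
    · exact ⟨y k, .inr (hy k), A.distLE_iff.mp hx⟩

theorem ClosureType.Sat.exists_closureIso {B : BaseSeq V} {S : Sig V} {m : ℕ} {n₁ n₂ : ℕ+}
    {X : Type} {p : ClosureType S m X} {A₁ : B.W S n₁} {A₂ : B.W S n₂} {a₁ : X → B.dom n₁}
    {a₂ : X → B.dom n₂} (h₁ : p.Sat B n₁ A₁.1 a₁) (h₂ : p.Sat B n₂ A₂.1 a₂) :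
    ∃ r, ClosureIso B m A₁ A₂ a₁ a₂ r := by
  obtain ⟨e₁, he₁, hd₁⟩ := h₁.exists_enumeration
  obtain ⟨e₂, he₂, hd₂⟩ := h₂.exists_enumeration
  exact ⟨_, he₁.closureIso he₂ hd₁ hd₂⟩

/-- Every tuple satisfies a complete closure type. -/
theorem exists_closureType_sat {B : BaseSeq V} {S : Sig V} (m : ℕ) {n : ℕ+} {X : Type}
    (A : B.W S n) (a : X → B.dom n) : ∃ p : ClosureType S m X, p.Sat B n A.1 a := by
  let e := Finite.equivFin {c // B.Rare m n c}
  obtain ⟨p, hp⟩ := exists_nbhdType_sat m A.1 (Sum.elim a fun i => (e.symm i).1)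
  exact ⟨⟨_, p⟩, _, fun i => (e.symm i).2, fun u hu => ⟨e ⟨u, hu⟩, by simp⟩, hp⟩

/-! ### Independent events -/

section

open Classical in
/-- The probability of the outcome `S` of independent events of which the `i`-th has probability
`w i`. -/
def bernWeight {ι : Type} [Fintype ι] (w : ι → ℝ) (S : ι → Prop) : ℝ :=
  ∏ i, if S i then w i else 1 - w i

open Classical in
/-- The probability that the set of outcomes of independent events, of which the `i`-th has
probability `w i`, satisfies `E`. -/
def bern {ι : Type} [Fintype ι] (w : ι → ℝ) (E : (ι → Prop) → Prop) : ℝ :=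
  ∑ S, if E S then bernWeight w S else 0

variable {ι κ : Type} [Fintype ι] [Fintype κ]

open Classical in
theorem sum_bernWeight (w : ι → ℝ) : ∑ S, bernWeight w S = 1 := by
  have h := Finset.prod_univ_sum (fun _ : ι => (Finset.univ : Finset Prop))
    fun i P => if P then w i else 1 - w i
  rw [Fintype.piFinset_univ] at h
  exact h.symm.trans (by simp)

theorem bernWeight_nonneg {w : ι → ℝ} (hw : ∀ i, w i ∈ Set.Icc (0 : ℝ) 1) (S : ι → Prop) :
    0 ≤ bernWeight w S := by
  refine Finset.prod_nonneg fun i _ => ?_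
  have := hw i
  split_ifs
  · exact this.1
  · linarith [this.2]

theorem bern_mem_Icc {w : ι → ℝ} (hw : ∀ i, w i ∈ Set.Icc (0 : ℝ) 1) (E : (ι → Prop) → Prop) :
    bern w E ∈ Set.Icc (0 : ℝ) 1 := by
  classical
  refine ⟨Finset.sum_nonneg fun S _ => ?_, ?_⟩
  · split_ifs
    exacts [bernWeight_nonneg hw S, le_rfl]
  · refine le_of_le_of_eq ?_ (sum_bernWeight w)
    refine Finset.sum_le_sum fun S _ => ?_
    split_ifs
    exacts [le_rfl, bernWeight_nonneg hw S]

theorem bern_true (w : ι → ℝ) : (bern w fun _ => True) = 1 := by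
  simpa [bern] using sum_bernWeight w

/-- An event that depends only on the coordinates in the range of an injection `j` has the same
probability with respect to the marginal distribution on these coordinates. -/
theorem bern_comp {j : κ → ι} (hj : Function.Injective j) (w : ι → ℝ) (E : (κ → Prop) → Prop) :
    (bern w fun S => E (S ∘ j)) = bern (w ∘ j) E := by
  classical
  let p : ι → Prop := fun i => i ∈ Set.range j
  let e : κ ≃ {i // p i} := Equiv.ofInjective j hj
  have hsplit : ∀ S : ι → Prop, bernWeight w S =
      bernWeight (w ∘ j) (S ∘ j) * bernWeight (fun i : {i // ¬ p i} => w i) (fun i => S i.1) := by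
    intro S
    rw [bernWeight, ← Fintype.prod_subtype_mul_prod_subtype p, bernWeight, bernWeight]
    congr 1
    let : Fintype {i // p i} := Subtype.fintype p
    exact (Fintype.prod_equiv e (fun k => if S (j k) then w (j k) else 1 - w (j k))
      (fun i => if S i.1 then w i.1 else 1 - w i.1) fun _ => rfl).symm
  let g : (ι → Prop) ≃ (κ → Prop) × ({i // ¬ p i} → Prop) :=
    (Equiv.piEquivPiSubtypeProd p fun _ => Prop).trans
      ((Equiv.arrowCongr e.symm (Equiv.refl Prop)).prodCongr (Equiv.refl _))
  have hg : ∀ S, g S = (S ∘ j, fun i => S i.1) := fun S => rfl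
  let f : (κ → Prop) × ({i // ¬ p i} → Prop) → ℝ := fun T =>
    (if E T.1 then bernWeight (w ∘ j) T.1 else 0) *
      bernWeight (fun i : {i // ¬ p i} => w i) T.2
  calc (bern w fun S => E (S ∘ j))
      = ∑ T, f T := by
        refine Fintype.sum_equiv g _ f fun S => ?_
        rw [hg, hsplit]
        exact (ite_zero_mul _ _ _).symm
    _ = bern (w ∘ j) E := by
        rw [Fintype.sum_prod_type]
        refine Finset.sum_congr rfl fun T _ => ?_
        simp only [f, ← Finset.mul_sum]
        refine (congrArg _ (?_ : _ = (1 : ℝ))).trans (mul_one _)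
        exact (Finset.sum_congr (by ext; simp) fun _ _ => rfl).trans
          (sum_bernWeight fun i : {i // ¬ p i} => w i)

theorem abs_prod_sub_prod_le {a b : ι → ℝ} (ha : ∀ i, |a i| ≤ 1) (hb : ∀ i, |b i| ≤ 1) {ε : ℝ}
    (hab : ∀ i, |a i - b i| ≤ ε) : |∏ i, a i - ∏ i, b i| ≤ Fintype.card ι * ε := by
  classical
  have : ∀ s : Finset ι, |∏ i ∈ s, a i - ∏ i ∈ s, b i| ≤ s.card * ε := by
    intro s
    induction s using Finset.induction_on with
    | empty => simp
    | insert i s hi ih =>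
      rw [Finset.prod_insert hi, Finset.prod_insert hi, Finset.card_insert_of_notMem hi]
      have h1 : |∏ i ∈ s, b i| ≤ 1 := by
        rw [Finset.abs_prod]
        exact Finset.prod_le_one (fun _ _ => abs_nonneg _) fun i _ => hb i
      calc |a i * ∏ i ∈ s, a i - b i * ∏ i ∈ s, b i|
          = |a i * (∏ i ∈ s, a i - ∏ i ∈ s, b i) + (a i - b i) * ∏ i ∈ s, b i| := by
            congr 1; ring
        _ ≤ |a i| * |∏ i ∈ s, a i - ∏ i ∈ s, b i| + |a i - b i| * |∏ i ∈ s, b i| := by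
            rw [← abs_mul, ← abs_mul]
            exact abs_add_le _ _
        _ ≤ 1 * (s.card * ε) + ε * 1 := by
            gcongr
            · exact ha i
            · exact (abs_nonneg _).trans (hab i)
            · exact hab i
        _ = (s.card + 1 : ℕ) * ε := by push_cast; ring
  exact this Finset.univ

theorem abs_bern_sub_bern_le {w w' : ι → ℝ} (hw : ∀ i, w i ∈ Set.Icc (0 : ℝ) 1)
    (hw' : ∀ i, w' i ∈ Set.Icc (0 : ℝ) 1) {ε : ℝ} (hww' : ∀ i, |w i - w' i| ≤ ε)
    (E : (ι → Prop) → Prop) :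
    |bern w E - bern w' E| ≤ 2 ^ Fintype.card ι * (Fintype.card ι * ε) := by
  classical
  have hS : ∀ S, |(if E S then bernWeight w S else 0) - (if E S then bernWeight w' S else 0)|
      ≤ Fintype.card ι * ε := by
    intro S
    have h : |bernWeight w S - bernWeight w' S| ≤ Fintype.card ι * ε := by
      refine abs_prod_sub_prod_le (fun i => ?_) (fun i => ?_) fun i => ?_
      · have := hw i
        split_ifs <;> rw [abs_le] <;> constructor <;> linarith [this.1, this.2]
      · have := hw' i
        split_ifs <;> rw [abs_le] <;> constructor <;> linarith [this.1, this.2]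
      · split_ifs
        · exact hww' i
        · rw [sub_sub_sub_cancel_left, abs_sub_comm]
          exact hww' i
    split_ifs
    · exact h
    · simpa using (abs_nonneg _).trans h
  rw [bern, bern, ← Finset.sum_sub_distrib]
  refine (Finset.abs_sum_le_sum_abs _ _).trans ((Finset.sum_le_sum fun S _ => hS S).trans ?_)
  simp

end

/-! ### Expansions by new relation symbols -/

/-- The symbols of `T` which do not belong to `S`. -/
def NewSym (S T : Sig V) : Type :=
  {R : {R : V.Sym // R ∉ V.tau} // R.1 ∈ T.carrier ∧ R.1 ∉ S.carrier}

instance (S T : Sig V) : Fintype (NewSym S T) :=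
  @Fintype.ofFinite _ (by unfold NewSym; infer_instance)

/-- The atoms `R(v)` where `R` belongs to `T` but not to `S` and `v` is a tuple in `D`. -/
abbrev Atoms (S T : Sig V) (D : Type) : Type :=
  Σ R : NewSym S T, Fin (V.arity R.1.1) → D

/-- The image of an atom under a map of the domain. -/
def Atoms.map {S T : Sig V} {C D : Type} (f : C → D) (i : Atoms S T C) : Atoms S T D :=
  ⟨i.1, f ∘ i.2⟩

theorem Atoms.map_injective {S T : Sig V} {C D : Type} {f : C → D} (hf : Function.Injective f) :
    Function.Injective (Atoms.map (S := S) (T := T) f) := by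
  rintro ⟨R, v⟩ ⟨R', v'⟩ h
  obtain rfl : R = R' := congrArg Sigma.fst h
  have h2 : f ∘ v = f ∘ v' := eq_of_heq (Sigma.mk.inj h).2
  rw [hf.comp_left h2]

open Classical in
/-- The expansion of `A` to `T` in which `P` is the set of true new atoms. -/
def glue {S T : Sig V} {D : Type} (A : Str S D) (P : Atoms S T D → Prop) : Str T D := fun R v =>
  if h : R.1 ∈ S.carrier then A ⟨R.1, h⟩ v
  else P ⟨⟨⟨R.1, fun ht => h (S.tau_subset ht)⟩, R.2, h⟩, v⟩

theorem glue_old {S T : Sig V} {D : Type} (A : Str S D) (P : Atoms S T D → Prop) {R : V.Sym}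
    (hT : R ∈ T.carrier) (h : R ∈ S.carrier) (v : Fin (V.arity R) → D) :
    glue A P ⟨R, hT⟩ v ↔ A ⟨R, h⟩ v := by
  rw [glue, dif_pos h]

theorem glue_new {S T : Sig V} {D : Type} (A : Str S D) (P : Atoms S T D → Prop) {R : V.Sym}
    (hT : R ∈ T.carrier) (h : R ∉ S.carrier) (v : Fin (V.arity R) → D) :
    glue A P ⟨R, hT⟩ v ↔ P ⟨⟨⟨R, fun ht => h (S.tau_subset ht)⟩, hT, h⟩, v⟩ := by
  rw [glue, dif_neg h]

theorem reduct_glue {S T U : Sig V} {D : Type} (hUS : U.carrier ⊆ S.carrier)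
    (hUT : U.carrier ⊆ T.carrier) (A : Str S D) (P : Atoms S T D → Prop) :
    reduct hUT (glue A P) = reduct hUS A := by
  funext R v
  exact propext (glue_old A P (hUT R.2) (hUS R.2) v)

/-- The expansion of `A ∈ W_n` in which `P` is the set of true new atoms. -/
def BaseSeq.W.glue {B : BaseSeq V} {S T : Sig V} {n : ℕ+} (A : B.W S n)
    (P : Atoms S T (B.dom n) → Prop) : B.W T n :=
  ⟨PLANet.glue A.1 P, (reduct_glue S.tau_subset T.tau_subset A.1 P).trans A.2⟩

theorem BaseSeq.W.glue_old {B : BaseSeq V} {S T : Sig V} {n : ℕ+} (A : B.W S n)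
    (P : Atoms S T (B.dom n) → Prop) (R : T.carrier) (h : R.1 ∈ S.carrier)
    (v : Fin (V.arity R) → B.dom n) : (A.glue P).1 R v ↔ A.1 ⟨R.1, h⟩ v :=
  PLANet.glue_old A.1 P R.2 h v

theorem BaseSeq.W.glue_new {B : BaseSeq V} {S T : Sig V} {n : ℕ+} (A : B.W S n)
    (P : Atoms S T (B.dom n) → Prop) (R : T.carrier) (h : R.1 ∉ S.carrier)
    (v : Fin (V.arity R) → B.dom n) :
    (A.glue P).1 R v ↔ P ⟨⟨⟨R.1, fun ht => h (S.tau_subset ht)⟩, R.2, h⟩, v⟩ :=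
  PLANet.glue_new A.1 P R.2 h v

/-- An expansion to `T ⊇ S` consists of an expansion to `S` and a set of new atoms. -/
def BaseSeq.W.glueEquiv (B : BaseSeq V) {S T : Sig V} (hST : S.carrier ⊆ T.carrier) (n : ℕ+) :
    B.W S n × (Atoms S T (B.dom n) → Prop) ≃ B.W T n where
  toFun x := x.1.glue x.2
  invFun A := (⟨reduct hST A.1, A.2⟩, fun i => A.1 ⟨i.1.1.1, i.1.2.1⟩ i.2)
  left_inv x := by
    refine Prod.ext (Subtype.ext (reduct_glue subset_rfl hST x.1.1 x.2)) ?_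
    funext i
    exact propext (PLANet.glue_new x.1.1 x.2 i.1.2.1 i.1.2.2 i.2)
  right_inv A := by
    refine Subtype.ext ?_
    funext R v
    by_cases h : R.1 ∈ S.carrier
    · exact propext (PLANet.glue_old _ _ R.2 h v)
    · exact propext (PLANet.glue_new _ _ R.2 h v)

namespace Network

variable (G : Network V)

/-- The probability which the network assigns to a new atom when the parents of the new symbols
belong to `S`. -/
def atomProb {S T : Sig V} (hpar : ∀ R : NewSym S T, (G.parSig R.1).carrier ⊆ S.carrier) {D : Type}
    [Fintype D] (A : Str S D) (i : Atoms S T D) : ℝ :=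
  (((G.θ i.1.1).eval (reduct (S := G.parSig i.1.1) (hpar i.1) A) i.2 : unitInterval) : ℝ)

theorem atomProb_mem_Icc {S T : Sig V}
    (hpar : ∀ R : NewSym S T, (G.parSig R.1).carrier ⊆ S.carrier) {D : Type}
    [Fintype D] (A : Str S D) (i : Atoms S T D) : G.atomProb hpar A i ∈ Set.Icc (0 : ℝ) 1 :=
  ((G.θ i.1.1).eval (reduct (S := G.parSig i.1.1) (hpar i.1) A) i.2).2

/-- Given the relations of `S`, the new atoms are independent. -/
theorem weight_glue {S T : Sig V} (hST : S.carrier ⊆ T.carrier) (hS : G.Closed S) (hT : G.Closed T)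
    (hpar : ∀ R : NewSym S T, (G.parSig R.1).carrier ⊆ S.carrier) {D : Type} [Fintype D]
    (A : Str S D) (P : Atoms S T D → Prop) :
    G.weight hT (glue A P) = G.weight hS A * bernWeight (G.atomProb hpar A) P := by
  classical
  rw [weight, ← Fintype.prod_subtype_mul_prod_subtype fun R => R.1.1 ∈ S.carrier, weight,
    bernWeight, Fintype.prod_sigma]
  congr 1
  · refine Fintype.prod_equiv ⟨fun R => ⟨R.1.1, R.2⟩, fun R => ⟨⟨R.1, hST R.2⟩, R.2⟩,
      fun _ => rfl, fun _ => rfl⟩ _ _ ?_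
    rintro ⟨⟨R, hRT⟩, hRS⟩
    refine Finset.prod_congr rfl fun v _ => ?_
    rw [reduct_glue (hS R hRS) (hT R hRT) A P]
    simp only [glue_old A P hRT hRS v]
    rfl
  · refine Fintype.prod_equiv ⟨fun R => ⟨R.1.1, R.1.2, R.2⟩, fun R => ⟨⟨R.1, R.2.1⟩, R.2.2⟩,
      fun _ => rfl, fun _ => rfl⟩ _ _ ?_
    rintro ⟨⟨R, hRT⟩, hRS⟩
    refine Finset.prod_congr rfl fun v _ => ?_
    rw [reduct_glue (hpar ⟨R, hRT, hRS⟩) (hT R hRT) A P]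
    simp only [glue_new A P hRT hRS v]
    rfl

theorem weight_nonneg {S : Sig V} (hS : G.Closed S) {D : Type} [Fintype D] (A : Str S D) :
    0 ≤ G.weight hS A := by
  refine Finset.prod_nonneg fun R _ => Finset.prod_nonneg fun v _ => ?_
  have := ((G.θ R.1).eval (reduct (S := G.parSig R.1) (hS R.1 R.2) A) v).2
  split_ifs
  exacts [this.1, sub_nonneg.mpr this.2]

theorem prob_eq_sum_bern {S T : Sig V} (hST : S.carrier ⊆ T.carrier) (hS : G.Closed S)
    (hT : G.Closed T) (hpar : ∀ R : NewSym S T, (G.parSig R.1).carrier ⊆ S.carrier) (B : BaseSeq V)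
    (n : ℕ+) (E : B.W T n → Prop) :
    G.prob hT B n E =
      ∑ A : B.W S n, G.weight hS A.1 * bern (G.atomProb hpar A.1) fun P => E (A.glue P) := by
  classical
  rw [prob, ← Fintype.sum_equiv (BaseSeq.W.glueEquiv B hST n) _ _ fun _ => rfl,
    Fintype.sum_prod_type]
  refine Finset.sum_congr rfl fun A _ => ?_
  rw [bern, Finset.mul_sum]
  refine Finset.sum_congr (by ext; simp) fun P _ => ?_
  rw [mul_ite, mul_zero]
  exact if_congr Iff.rfl (G.weight_glue hST hS hT hpar A.1 P) rfl

theorem prob_true_eq {S T : Sig V} (hST : S.carrier ⊆ T.carrier) (hS : G.Closed S)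
    (hT : G.Closed T) (hpar : ∀ R : NewSym S T, (G.parSig R.1).carrier ⊆ S.carrier) (B : BaseSeq V)
    (n : ℕ+) : (G.prob hT B n fun _ => True) = G.prob hS B n fun _ => True := by
  rw [G.prob_eq_sum_bern hST hS hT hpar]
  simp [bern_true, prob]

/-- The induced distributions are probability distributions. -/
theorem prob_true {S : Sig V} (hS : G.Closed S) (B : BaseSeq V) (n : ℕ+) :
    (G.prob hS B n fun _ => True) = 1 := by
  -- Induction on the rank: the symbols of maximal rank in `S` have all their parents among the
  -- other symbols, and may be removed without changing the total mass.
  have key : ∀ (m : ℕ) (S : Sig V) (hS : G.Closed S),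
      (∀ R : {R : V.Sym // R ∉ V.tau}, R.1 ∈ S.carrier → G.mp R < m) →
      (G.prob hS B n fun _ => True) = 1 := by
    intro m
    induction m with
    | zero =>
      intro S hS hm
      have hτ : S.carrier ⊆ V.tau := fun R hR => by
        by_contra h
        exact absurd (hm ⟨R, h⟩ hR) (Nat.not_lt_zero _)
      have : IsEmpty {R : {R : V.Sym // R ∉ V.tau} // R.1 ∈ S.carrier} :=
        ⟨fun R => R.1.2 (hτ R.2)⟩
      let A₀ : B.W S n := ⟨fun R => B.str n ⟨R.1, hτ R.2⟩, rfl⟩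
      have huniq : ∀ A : B.W S n, A = A₀ := by
        intro A
        refine Subtype.ext (funext fun R => ?_)
        exact congrFun A.2 ⟨R.1, hτ R.2⟩
      rw [prob, Fintype.sum_eq_single A₀ fun A hA => absurd (huniq A) hA]
      simp [weight]
    | succ m ih =>
      intro T hT hm
      let S : Sig V := ⟨{R | R ∈ T.carrier ∧ (R ∈ V.tau ∨ ∃ h : R ∉ V.tau, G.mp ⟨R, h⟩ < m)},
        fun R hR => ⟨T.tau_subset hR, .inl hR⟩⟩
      have hpar : ∀ R : {R : V.Sym // R ∉ V.tau}, R.1 ∈ T.carrier →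
          (G.parSig R).carrier ⊆ S.carrier := by
        intro R hR Q hQ
        refine ⟨hT R hR hQ, hQ.imp id ?_⟩
        rintro ⟨hQτ, hE⟩
        exact ⟨hQτ, (G.mp_lt_mp hE).trans_le (Nat.le_of_lt_succ (hm R hR))⟩
      have hS : G.Closed S := fun R hR => hpar R hR.1
      have hST : S.carrier ⊆ T.carrier := fun _ hR => hR.1
      rw [G.prob_true_eq hST hS hT (fun R => hpar R.1 R.2.1) B n]
      refine ih S hS fun R hR => ?_
      obtain h | ⟨_, h⟩ := hR.2
      exacts [absurd h R.2, h]
  refine key (sSup {m | ∃ R, G.HasPath m R} + 1) S hS fun R _ => Nat.lt_succ_of_le ?_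
  exact csSup_le_csSup' G.bddAbove_path fun m hm => ⟨R, hm⟩

theorem sum_weight {S : Sig V} (hS : G.Closed S) (B : BaseSeq V) (n : ℕ+) :
    ∑ A : B.W S n, G.weight hS A.1 = 1 := by
  simpa [prob] using G.prob_true hS B n

end Network

/-! ### The conditional probability of a closure type -/

theorem BaseSeq.InClosure.mono {B : BaseSeq V} {i j : ℕ} (hij : i ≤ j) {n : ℕ+} {X : Type}
    {a : X → B.dom n} {c : B.dom n} (h : B.InClosure i a c) : B.InClosure j a c :=
  let ⟨w, hw, hcw⟩ := h
  ⟨w, hw.mono hij, hcw.mono hij⟩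

theorem ClosureIso.refl {B : BaseSeq V} {S : Sig V} (m : ℕ) {n : ℕ+} (A : B.W S n) {X : Type}
    (a : X → B.dom n) : ClosureIso B m A A a a Eq where
  iso := ⟨by rintro _ _ _ _ rfl rfl; exact Iff.rfl, fun R v w h => by rw [funext h]⟩
  tuple _ := rfl
  rare := by rintro _ _ rfl; exact Iff.rfl
  dom c hc := ⟨c, rfl, hc⟩
  ran c hc := ⟨c, rfl, hc⟩

/-- The `m`-closure of a tuple, as a type. -/
abbrev BaseSeq.ClosureOf (B : BaseSeq V) (m : ℕ) {n : ℕ+} {X : Type} (a : X → B.dom n) : Type :=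
  {c // B.InClosure m a c}

/-- The closure type `p` holds at `a` in the expansion of `A` whose new atoms are those of `Q`, a
set of atoms over the closure of `a`. -/
def ClosureType.localEvent {B : BaseSeq V} {S T : Sig V} {m : ℕ} {X : Type} (p : ClosureType T m X)
    {n : ℕ+} (A : B.W S n) (a : X → B.dom n) (Q : Atoms S T (B.ClosureOf m a) → Prop) : Prop :=
  p.Sat B n (A.glue fun i => ∃ i', Atoms.map Subtype.val i' = i ∧ Q i').1 a

section

variable {B : BaseSeq V} {S T : Sig V} {m : ℕ} {n₁ n₂ : ℕ+} {A₁ : B.W S n₁} {A₂ : B.W S n₂}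
  {X : Type} {a₁ : X → B.dom n₁} {a₂ : X → B.dom n₂} {r : B.dom n₁ → B.dom n₂ → Prop}

/-- Whether `p` holds at `a₂` in an expansion of `A₂` depends only on the new atoms over the closure
of `a₂`, which may be transported to an isomorphic closure. -/
theorem ClosureIso.sat_glue_iff (h : ClosureIso B m A₁ A₂ a₁ a₂ r)
    {f : B.ClosureOf m a₁ → B.dom n₂} (hf : ∀ c, r c.1 (f c)) (p : ClosureType T m X)
    (P : Atoms S T (B.dom n₂) → Prop) :
    p.Sat B n₂ (A₂.glue P).1 a₂ ↔ p.localEvent A₁ a₁ (P ∘ Atoms.map f) := by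
  have hf' : ∀ c, B.InClosure m a₂ (f c) := fun c => by
    obtain ⟨d, hd, hd'⟩ := h.dom _ c.2
    rwa [← (h.iso.eq_iff hd (hf c)).mp rfl]
  refine (ClosureIso.sat_iff (r := fun c d => ∃ hc, f ⟨c, hc⟩ = d)
    ⟨⟨?_, ?_⟩, ?_, ?_, ?_, ?_⟩ p).symm
  · rintro c c' _ _ ⟨hc, rfl⟩ ⟨hc', rfl⟩
    exact h.iso.eq_iff (hf ⟨c, hc⟩) (hf ⟨c', hc'⟩)
  · intro R v w hvw
    by_cases hR : R.1 ∈ S.carrier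
    · refine (A₁.glue_old _ R hR v).trans (Iff.trans ?_ (A₂.glue_old P R hR w).symm)
      refine h.iso.rel_iff ⟨R.1, hR⟩ v w fun i => ?_
      obtain ⟨hc, hi⟩ := hvw i
      exact hi ▸ hf ⟨v i, hc⟩
    · refine (A₁.glue_new _ R hR v).trans (Iff.trans ?_ (A₂.glue_new P R hR w).symm)
      choose hv hw using hvw
      obtain rfl : (fun i => f ⟨v i, hv i⟩) = w := funext hw
      let i₀ : Atoms S T (B.ClosureOf m a₁) :=
        ⟨⟨⟨R.1, fun ht => hR (S.tau_subset ht)⟩, R.2, hR⟩, fun i => ⟨v i, hv i⟩⟩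
      constructor
      · rintro ⟨i', hi', hP⟩
        obtain rfl : i' = i₀ := Atoms.map_injective Subtype.val_injective hi'
        exact hP
      · exact fun hP => ⟨i₀, rfl, hP⟩
  · exact fun x => ⟨BaseSeq.Center.inClosure (.inl ⟨x, rfl⟩),
      (h.iso.eq_iff (hf ⟨a₁ x, _⟩) (h.tuple x)).mp rfl⟩
  · rintro c _ ⟨hc, rfl⟩
    exact h.rare _ _ (hf ⟨c, hc⟩)
  · exact fun c hc => ⟨_, ⟨hc, rfl⟩, hf' ⟨c, hc⟩⟩
  · intro d hd
    obtain ⟨c, hcd, hc⟩ := h.ran d hd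
    exact ⟨c, ⟨hc, (h.iso.eq_iff (hf ⟨c, hc⟩) hcd).mp rfl⟩, hc⟩

instance {n : ℕ+} (a : X → B.dom n) : Fintype (B.ClosureOf m a) := Fintype.ofFinite _

/-- The probability of `p` given `A₂`, computed on the closure of `a₁`. -/
theorem ClosureIso.bern_sat (h : ClosureIso B m A₁ A₂ a₁ a₂ r)
    {f : B.ClosureOf m a₁ → B.dom n₂} (hf : ∀ c, r c.1 (f c)) (p : ClosureType T m X)
    (w : Atoms S T (B.dom n₂) → ℝ) :
    (bern w fun P => p.Sat B n₂ (A₂.glue P).1 a₂) =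
      bern (w ∘ Atoms.map f) (p.localEvent A₁ a₁) := by
  have hinj : Function.Injective f := fun c c' hcc =>
    Subtype.ext ((h.iso.eq_iff (hf c) (hf c')).mpr hcc)
  rw [← bern_comp (Atoms.map_injective hinj)]
  congr 1
  funext P
  exact propext (h.sat_glue_iff hf p P)

/-- The conditional probability of a closure type is invariant under isomorphisms between closures
which preserve the probabilities of the new atoms. -/
theorem ClosureIso.bern_sat_eq (h : ClosureIso B m A₁ A₂ a₁ a₂ r) (p : ClosureType T m X)
    {w₁ : Atoms S T (B.dom n₁) → ℝ} {w₂ : Atoms S T (B.dom n₂) → ℝ}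
    (hw : ∀ R v₁ v₂, (∀ i, B.InClosure m a₁ (v₁ i)) → (∀ i, r (v₁ i) (v₂ i)) →
      w₁ ⟨R, v₁⟩ = w₂ ⟨R, v₂⟩) :
    (bern w₁ fun P => p.Sat B n₁ (A₁.glue P).1 a₁) =
      bern w₂ fun P => p.Sat B n₂ (A₂.glue P).1 a₂ := by
  have : ∀ c : B.ClosureOf m a₁, ∃ d, r c.1 d := fun c => let ⟨d, hd, _⟩ := h.dom _ c.2; ⟨d, hd⟩
  choose f hf using this
  rw [(ClosureIso.refl m A₁ a₁).bern_sat (f := Subtype.val) (fun _ => rfl), h.bern_sat hf]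
  congr 1
  funext i
  exact hw i.1 _ _ (fun k => (i.2 k).2) fun k => hf (i.2 k)

theorem card_atoms_le {C : Type} [Fintype C] {K : ℕ} (hK : Fintype.card C ≤ K) :
    Fintype.card (Atoms S T C) ≤ ∑ R : NewSym S T, K ^ V.arity R.1.1 := by
  rw [Fintype.card_sigma]
  refine Finset.sum_le_sum fun R _ => ?_
  rw [Fintype.card_fun, Fintype.card_fin]
  exact Nat.pow_le_pow_left hK _

/-- The conditional probability of a closure type depends continuously on the probabilities of the
new atoms, with a modulus that depends only on a bound `K` for the size of the closure. -/
theorem abs_bern_sat_sub_le {n : ℕ+} (A : B.W S n) (a : X → B.dom n) (p : ClosureType T m X)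
    {K : ℕ} (hK : Fintype.card (B.ClosureOf m a) ≤ K) {w w' : Atoms S T (B.dom n) → ℝ}
    (hw : ∀ i, w i ∈ Set.Icc (0 : ℝ) 1) (hw' : ∀ i, w' i ∈ Set.Icc (0 : ℝ) 1) {ε : ℝ} (hε : 0 ≤ ε)
    (hww' : ∀ i, |w i - w' i| ≤ ε) :
    |(bern w fun P => p.Sat B n (A.glue P).1 a) - bern w' fun P => p.Sat B n (A.glue P).1 a| ≤
      2 ^ (∑ R : NewSym S T, K ^ V.arity R.1.1) *
        ((∑ R : NewSym S T, K ^ V.arity R.1.1 : ℕ) * ε) := by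
  have h := ClosureIso.refl m A a
  rw [h.bern_sat (f := Subtype.val) (fun _ => rfl), h.bern_sat (f := Subtype.val) (fun _ => rfl)]
  refine (abs_bern_sub_bern_le (fun i => hw _) (fun i => hw' _) (fun i => hww' _) _).trans ?_
  have hc := card_atoms_le (S := S) (T := T) hK
  gcongr
  norm_num

end

/-! ### Basic formulas -/

namespace BasicFormula

variable {B : BaseSeq V} {S : Sig V} {kap : ℕ} {X : Type}

theorem eval_mem_Icc (χ : BasicFormula S kap X) {n : ℕ+} (A : Str S (B.dom n)) (a : X → B.dom n) :
    χ.eval B n A a ∈ Set.Icc (0 : ℝ) 1 := by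
  rw [eval]
  refine ⟨Finset.le_fold_min _ |>.mpr ⟨zero_le_one, fun i _ => le_min zero_le_one ?_⟩,
    Finset.fold_min_le _ |>.mpr (.inl le_rfl)⟩
  have := (χ.c i).2.1
  split_ifs <;> linarith

/-- The value of a basic formula depends only on the closure types of the tuple. -/
theorem eval_eq (χ : BasicFormula S kap X) {n₁ n₂ : ℕ+} {A₁ : B.W S n₁} {A₂ : B.W S n₂}
    {a₁ : X → B.dom n₁} {a₂ : X → B.dom n₂} {r : B.dom n₁ → B.dom n₂ → Prop}
    (h : ∀ j ≤ kap, ClosureIso B j A₁ A₂ a₁ a₂ r) :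
    χ.eval B n₁ A₁.1 a₁ = χ.eval B n₂ A₂.1 a₂ := by
  rw [eval, eval]
  congr 1
  funext i
  classical
  have : (∀ hX, (χ.φ hX i).Sat B n₁ A₁.1 a₁) ↔ ∀ hX, (χ.φ hX i).Sat B n₂ A₂.1 a₂ :=
    forall_congr' fun hX => (h _ (χ.lam_le i)).sat_iff _
  exact congrArg (fun x : ℝ => min 1 (1 - x + _)) (if_congr this rfl rfl)

end BasicFormula

/-! ### Finitely many types of expansions of a given base type -/

/-- The tuples of a fixed base type have, in the expansions to `S`, only finitely many closure types
of smaller radius, and these exclude each other. -/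
theorem exists_finite_closureTypes {B : BaseSeq V} (S : Sig V) {m M : ℕ} (hmM : m ≤ M) {X : Type}
    [Finite X] (pτ : ClosureType (Sig.base V) M X) :
    ∃ (I : Type) (_ : Fintype I) (t : I → ClosureType S m X), ∀ n (a : X → B.dom n),
      pτ.Sat B n (B.str n) a → ∀ A : B.W S n, ∃! i, (t i).Sat B n A.1 a := by
  classical
  let Q := {s : Σ n, B.W S n × (X → B.dom n) // pτ.Sat B s.1 (B.str s.1) s.2.2}
  have henum : ∀ s : Q, ∃ e : (X ⊕ Fin pτ.k) ⊕ Fin pτ.nbhd.l → B.dom s.1.1,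
      EnumeratesClosure B M s.1.2.2 e ∧ pτ.nbhd.diagram.Sat (B.str s.1.1) e := fun s =>
    ClosureType.Sat.exists_enumeration (A := (⟨B.str s.1.1, rfl⟩ : B.W (Sig.base V) s.1.1)) s.2
  choose e he _ using henum
  let code : Q → Diagram S ((X ⊕ Fin pτ.k) ⊕ Fin pτ.nbhd.l) := fun s =>
    Diagram.of s.1.2.1.1 (e s)
  -- Two realizations whose closures are listed with the same diagram satisfy the same types.
  let typ : Q → Set (ClosureType S m X) := fun s => {p | p.Sat B s.1.1 s.1.2.1.1 s.1.2.2}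
  have hcode : ∀ s s', code s = code s' → typ s = typ s' := by
    intro s s' hss
    ext p
    have h' : (code s).Sat s'.1.2.1.1 (e s') := hss ▸ Diagram.sat_of _ _
    exact (((he s).closureIso (he s') (Diagram.sat_of _ _) h').mono hmM).sat_iff p
  let rep : Set.range typ → Q := fun i => i.2.choose
  have hrep : ∀ i, typ (rep i) = i.1 := fun i => i.2.choose_spec
  have : Finite (Set.range typ) := Finite.of_injective (code ∘ rep) fun i i' hii =>
    Subtype.ext ((hrep i).symm.trans ((hcode _ _ hii).trans (hrep i')))
  choose t ht using fun i => exists_closureType_sat (S := S) m (rep i).1.2.1 (rep i).1.2.2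
  refine ⟨Set.range typ, Fintype.ofFinite _, t, fun n a ha A => ?_⟩
  let s : Q := ⟨⟨n, A, a⟩, ha⟩
  have hmem : ∀ i, t i ∈ i.1 := fun i => by
    rw [← hrep i]
    exact ht i
  obtain ⟨i₀, hi₀⟩ : ∃ i : Set.range typ, i.1 = typ s := ⟨⟨_, s, rfl⟩, rfl⟩
  refine ⟨i₀, show t i₀ ∈ typ s from hi₀ ▸ hmem i₀, fun i hi => Subtype.ext ?_⟩
  · obtain ⟨r, hr⟩ := (ht i).exists_closureIso hi
    rw [hi₀, ← hrep i]
    ext p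
    exact hr.sat_iff p

open Filter Topology

/-! ### Convergence along the realizations of a base type -/

/-- The pairs of an index `n → ∞` and a realization of `pτ` in `B_n`. -/
def realizationFilter (B : BaseSeq V) {M : ℕ} {X : Type} (pτ : ClosureType (Sig.base V) M X) :
    Filter (Σ n, X → B.dom n) :=
  comap Sigma.fst atTop ⊓ 𝓟 {s | pτ.Sat B s.1 (B.str s.1) s.2}

theorem eventually_realizationFilter {B : BaseSeq V} {M : ℕ} {X : Type}
    {pτ : ClosureType (Sig.base V) M X} {P : (Σ n, X → B.dom n) → Prop} :
    (∀ᶠ s in realizationFilter B pτ, P s) ↔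
      ∃ n₀ : ℕ+, ∀ n ≥ n₀, ∀ a, pτ.Sat B n (B.str n) a → P ⟨n, a⟩ := by
  rw [realizationFilter, eventually_inf_principal, eventually_comap, eventually_atTop]
  refine exists_congr fun n₀ => forall₂_congr fun n _ => ⟨fun h a => h ⟨n, a⟩ rfl, ?_⟩
  rintro h ⟨n', a⟩ rfl
  exact h a

theorem tendsto_fst_realizationFilter (B : BaseSeq V) {M : ℕ} {X : Type}
    (pτ : ClosureType (Sig.base V) M X) :
    Tendsto Sigma.fst (realizationFilter B pτ) atTop :=
  tendsto_comap.mono_left inf_le_left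

namespace Network

variable (G : Network V)

theorem prob_mono {S : Sig V} (hS : G.Closed S) (B : BaseSeq V) (n : ℕ+) {E F : B.W S n → Prop}
    (h : ∀ A, E A → F A) : G.prob hS B n E ≤ G.prob hS B n F := by
  classical
  refine Finset.sum_le_sum fun A _ => ?_
  by_cases hE : E A
  · rw [if_pos hE, if_pos (h A hE)]
  · rw [if_neg hE]
    split_ifs
    exacts [G.weight_nonneg hS A.1, le_rfl]

theorem prob_nonneg {S : Sig V} (hS : G.Closed S) (B : BaseSeq V) (n : ℕ+) (E : B.W S n → Prop) :
    0 ≤ G.prob hS B n E := by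
  classical
  refine Finset.sum_nonneg fun A _ => ?_
  split_ifs
  exacts [G.weight_nonneg hS A.1, le_rfl]

theorem prob_le_one {S : Sig V} (hS : G.Closed S) (B : BaseSeq V) (n : ℕ+) (E : B.W S n → Prop) :
    G.prob hS B n E ≤ 1 :=
  (G.prob_mono hS B n fun _ _ => trivial).trans_eq (G.prob_true hS B n)

theorem prob_exists_le {S : Sig V} (hS : G.Closed S) (B : BaseSeq V) (n : ℕ+) {I : Type} [Fintype I]
    (E : I → B.W S n → Prop) :
    (G.prob hS B n fun A => ∃ i, E i A) ≤ ∑ i, G.prob hS B n (E i) := by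
  classical
  simp only [prob]
  rw [Finset.sum_comm]
  refine Finset.sum_le_sum fun A _ => ?_
  have hnn : ∀ i ∈ Finset.univ, (0 : ℝ) ≤ if E i A then G.weight hS A.1 else 0 := fun i _ => by
    split_ifs
    exacts [G.weight_nonneg hS A.1, le_rfl]
  by_cases h : ∃ i, E i A
  · rw [if_pos h]
    obtain ⟨i, hi⟩ := h
    refine le_trans ?_ (Finset.single_le_sum hnn (Finset.mem_univ i))
    rw [if_pos hi]
  · rw [if_neg h]
    exact Finset.sum_nonneg hnn

/-- The truth of a base type does not depend on the expansion, so that conditioning on it amounts to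
a restriction to its realizations. -/
theorem convergesTo_iff_tendsto {S : Sig V} (hS : G.Closed S) (B : BaseSeq V) {M : ℕ} {X : Type}
    (φ : Query B S X) (pτ : ClosureType (Sig.base V) M X) (α : ℝ) :
    G.ConvergesTo hS B φ (pτ.toQuery B S S.tau_subset) α ↔
      Tendsto (fun s : Σ n, X → B.dom n => G.prob hS B s.1 fun A => φ s.1 A s.2)
        (realizationFilter B pτ) (𝓝 α) := by
  have hq : ∀ n (A : B.W S n) a,
      pτ.toQuery B S S.tau_subset n A a ↔ pτ.Sat B n (B.str n) a := by
    intro n A a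
    have : reduct (S := Sig.base V) S.tau_subset A.1 = B.str n := A.2
    exact this ▸ Iff.rfl
  simp only [Metric.nhds_basis_closedBall.tendsto_right_iff, eventually_realizationFilter,
    ConvergesTo, hq]
  refine forall₂_congr fun ε _ => exists_congr fun n₀ => forall₃_congr fun n _ a => ?_
  by_cases h : pτ.Sat B n (B.str n) a
  · simp only [h, and_true, G.prob_true hS B n, zero_lt_one, forall_const, div_one,
      Real.closedBall_eq_Icc]
  · simp [h, prob]

theorem converges_iff_tendsto {S : Sig V} (hS : G.Closed S) (B : BaseSeq V) {M : ℕ} {X : Type}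
    (φ : Query B S X) (pτ : ClosureType (Sig.base V) M X) :
    G.Converges hS B φ (pτ.toQuery B S S.tau_subset) ↔
      ∃ α : ℝ, Tendsto (fun s : Σ n, X → B.dom n => G.prob hS B s.1 fun A => φ s.1 A s.2)
        (realizationFilter B pτ) (𝓝 α) := by
  simp only [Converges, convergesTo_iff_tendsto]
  refine ⟨fun ⟨α, _, h⟩ => ⟨α, h⟩, fun ⟨α, h⟩ => ?_⟩
  -- If `pτ` has no realizations in `B_n` for large `n`, then every number is a limit.
  rcases (realizationFilter B pτ).eq_or_neBot with hbot | _
  · exact ⟨0, by simp, by rw [hbot]; exact tendsto_bot⟩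
  · exact ⟨α, isClosed_Icc.mem_of_tendsto h
      (.of_forall fun s => ⟨G.prob_nonneg hS B _ _, G.prob_le_one hS B _ _⟩), h⟩

/-! ### Replacing the probability formulas by basic formulas -/

section

variable {S T : Sig V} {B : BaseSeq V} {kap : ℕ}

/-- The values of the basic formulas `χ R` as probabilities of the new atoms. -/
def basicProb (χ : ∀ R : NewSym S T, BasicFormula S kap (Fin (V.arity R.1.1))) {n : ℕ+}
    (A : B.W S n) (i : Atoms S T (B.dom n)) : ℝ :=
  (χ i.1).eval B n A.1 i.2

/-- With basic formulas as probability formulas, the conditional probability of a closure type of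
radius `lam` depends only on the closure type of radius `lam + kap` over the smaller signature. -/
theorem bern_basicProb_eq (χ : ∀ R : NewSym S T, BasicFormula S kap (Fin (V.arity R.1.1)))
    {lam : ℕ} {X : Type} (p : ClosureType T lam X) (t : ClosureType S (lam + kap) X) {n₁ n₂ : ℕ+}
    {A₁ : B.W S n₁} {A₂ : B.W S n₂} {a₁ : X → B.dom n₁} {a₂ : X → B.dom n₂}
    (h₁ : t.Sat B n₁ A₁.1 a₁) (h₂ : t.Sat B n₂ A₂.1 a₂) :
    (bern (basicProb χ A₁) fun P => p.Sat B n₁ (A₁.glue P).1 a₁) =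
      bern (basicProb χ A₂) fun P => p.Sat B n₂ (A₂.glue P).1 a₂ := by
  obtain ⟨r, hr⟩ := h₁.exists_closureIso h₂
  refine (hr.mono (Nat.le_add_right lam kap)).bern_sat_eq p fun R v₁ v₂ hv hvr => ?_
  refine (χ R).eval_eq fun j hj => hr.restrict (i := lam) (by omega) hvr fun y => ?_
  obtain ⟨w, hw, hyw⟩ := hv y
  exact ⟨w, hw.mono (Nat.le_add_right lam kap), hyw⟩

/-- The mean value of the conditional probabilities is a combination, with constant coefficients, of
the probabilities of finitely many closure types. -/
theorem exists_sum_bern_basicProb_eq (hS : G.Closed S)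
    (χ : ∀ R : NewSym S T, BasicFormula S kap (Fin (V.arity R.1.1)))
    {lam M : ℕ} (hM : lam + kap ≤ M) {X : Type} [Finite X] (p : ClosureType T lam X)
    (pτ : ClosureType (Sig.base V) M X) :
    ∃ (I : Type) (_ : Fintype I) (t : I → ClosureType S (lam + kap) X) (c : I → ℝ),
      ∀ n (a : X → B.dom n), pτ.Sat B n (B.str n) a →
        ∑ A : B.W S n, G.weight hS A.1 * bern (basicProb χ A) (fun P => p.Sat B n (A.glue P).1 a) =
          ∑ i, c i * G.prob hS B n fun A => (t i).Sat B n A.1 a := by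
  classical
  obtain ⟨I, hI, t, ht⟩ := exists_finite_closureTypes S hM pτ (B := B)
  have hc : ∀ i, ∃ c : ℝ, ∀ n (A : B.W S n) (a : X → B.dom n), (t i).Sat B n A.1 a →
      bern (basicProb χ A) (fun P => p.Sat B n (A.glue P).1 a) = c := by
    intro i
    by_cases h : ∃ (n : ℕ+) (A : B.W S n) (a : X → B.dom n), (t i).Sat B n A.1 a
    · obtain ⟨n, A, a, h⟩ := h
      exact ⟨_, fun n' A' a' h' => bern_basicProb_eq χ p (t i) h' h⟩
    · exact ⟨0, fun n A a h' => absurd ⟨n, A, a, h'⟩ h⟩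
  choose c hc using hc
  refine ⟨I, hI, t, c, fun n a ha => ?_⟩
  simp only [prob, Finset.mul_sum]
  rw [Finset.sum_comm]
  refine Finset.sum_congr rfl fun A _ => ?_
  obtain ⟨i, hi, huniq⟩ := ht n a ha A
  rw [Fintype.sum_eq_single i fun j hj => ?_]
  · rw [if_pos hi, hc i n A a hi, mul_comm]
  · rw [if_neg fun h => hj (huniq j h), mul_zero]

/-- The closure of a realization of `pτ` has at most as many elements as `pτ` lists. -/
theorem card_closureOf_le {lam M : ℕ} (hM : lam ≤ M) {X : Type} {n : ℕ+} {a : X → B.dom n}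
    {pτ : ClosureType (Sig.base V) M X} (ha : pτ.Sat B n (B.str n) a) :
    Fintype.card (B.ClosureOf lam a) ≤ pτ.nbhd.l := by
  obtain ⟨e, he, -⟩ :=
    ClosureType.Sat.exists_enumeration (A := (⟨B.str n, rfl⟩ : B.W (Sig.base V) n)) ha
  choose f hf using fun c : B.ClosureOf lam a => (he.inClosure_iff c.1).mp (c.2.mono hM)
  refine (Fintype.card_le_of_injective f fun c c' hcc => Subtype.ext ?_).trans_eq
    (Fintype.card_fin _)
  rw [← hf c, ← hf c', hcc]

/-- If the probability formulas are asymptotically equivalent to basic formulas, then the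
probability of `p` is asymptotically given by the basic formulas. -/
theorem tendsto_prob_sub_sum_bern (hST : S.carrier ⊆ T.carrier) (hS : G.Closed S) (hT : G.Closed T)
    (hpar : ∀ R : NewSym S T, (G.parSig R.1).carrier ⊆ S.carrier)
    (χ : ∀ R : NewSym S T, BasicFormula S kap (Fin (V.arity R.1.1)))
    (hχ : ∀ R, ∀ ε > (0 : ℝ), Tendsto (fun n => G.prob hS B n fun A => ∃ v,
      ε < |G.atomProb hpar A.1 ⟨R, v⟩ - basicProb χ A ⟨R, v⟩|) atTop (𝓝 0))
    {lam M : ℕ} (hM : lam ≤ M) {X : Type} (p : ClosureType T lam X)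
    (pτ : ClosureType (Sig.base V) M X) :
    Tendsto (fun s : Σ n, X → B.dom n =>
      (G.prob hT B s.1 fun A => p.Sat B s.1 A.1 s.2) - ∑ A : B.W S s.1, G.weight hS A.1 *
        bern (basicProb χ A) (fun P => p.Sat B s.1 (A.glue P).1 s.2))
      (realizationFilter B pτ) (𝓝 0) := by
  classical
  let N : ℕ := ∑ R : NewSym S T, pτ.nbhd.l ^ V.arity R.1.1
  let K : ℝ := 2 ^ N * N
  have hK : 0 ≤ K := by positivity
  rw [Metric.tendsto_nhds]
  intro δ hδ
  -- The denominator makes the error `K * ε` of the good expansions less than `δ / 2`.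
  let ε : ℝ := δ / (2 * (K + 1))
  have hε : 0 < ε := by positivity
  have hKε : K * ε < δ / 2 := by
    have : (K + 1) * ε = δ / 2 := by
      simp only [ε]
      field_simp
    linarith
  let bad : ∀ n, B.W S n → Prop := fun n A =>
    ∃ (R : NewSym S T) (v : _), ε < |G.atomProb hpar A.1 ⟨R, v⟩ - basicProb χ A ⟨R, v⟩|
  have hbad : Tendsto (fun n => G.prob hS B n (bad n)) atTop (𝓝 0) := by
    refine squeeze_zero (fun n => G.prob_nonneg hS B n _) (fun n => G.prob_exists_le hS B n _) ?_
    have := tendsto_finsetSum Finset.univ fun R _ => hχ R ε hε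
    simpa using this
  have hev := (tendsto_fst_realizationFilter B pτ).eventually
    (hbad.eventually (gt_mem_nhds (half_pos hδ)))
  have hreal : ∀ᶠ s in realizationFilter B pτ, pτ.Sat B s.1 (B.str s.1) s.2 :=
    eventually_realizationFilter.mpr ⟨1, fun _ _ _ h => h⟩
  filter_upwards [hev, hreal] with s hs hsat
  rw [Real.dist_eq, sub_zero, G.prob_eq_sum_bern hST hS hT hpar, ← Finset.sum_sub_distrib]
  have hpoint : ∀ A : B.W S s.1,
      |(G.weight hS A.1 * bern (G.atomProb hpar A.1) fun P => p.Sat B s.1 (A.glue P).1 s.2) -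
        G.weight hS A.1 * bern (basicProb χ A) fun P => p.Sat B s.1 (A.glue P).1 s.2| ≤
      G.weight hS A.1 * (K * ε) + if bad s.1 A then G.weight hS A.1 else 0 := by
    intro A
    have hw := G.weight_nonneg hS A.1
    rw [← mul_sub, abs_mul, abs_of_nonneg hw]
    have hθ := G.atomProb_mem_Icc hpar A.1
    have hb : ∀ i, basicProb χ A i ∈ Set.Icc (0 : ℝ) 1 := fun i => (χ i.1).eval_mem_Icc _ _
    by_cases h : bad s.1 A
    -- In a bad expansion the two conditional probabilities still differ by at most `1`.
    · rw [if_pos h]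
      have h1 := bern_mem_Icc hθ fun P => p.Sat B s.1 (A.glue P).1 s.2
      have h2 := bern_mem_Icc hb fun P => p.Sat B s.1 (A.glue P).1 s.2
      have h3 := abs_sub_le_of_le_of_le h1.1 h1.2 h2.1 h2.2
      have h4 : 0 ≤ G.weight hS A.1 * (K * ε) := by positivity
      have h5 := mul_le_mul_of_nonneg_left h3 hw
      linarith
    · rw [if_neg h, add_zero]
      refine mul_le_mul_of_nonneg_left ?_ hw
      have hclose : ∀ i, |G.atomProb hpar A.1 i - basicProb χ A i| ≤ ε := fun i =>
        not_lt.mp fun hi => h ⟨i.1, i.2, hi⟩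
      refine (abs_bern_sat_sub_le A s.2 p (card_closureOf_le hM hsat) hθ hb hε.le
        hclose).trans_eq ?_
      exact (mul_assoc _ _ _).symm
  calc _ ≤ ∑ A : B.W S s.1,
        (G.weight hS A.1 * (K * ε) + if bad s.1 A then G.weight hS A.1 else 0) :=
        (Finset.abs_sum_le_sum_abs _ _).trans (Finset.sum_le_sum fun A _ => hpoint A)
    _ = K * ε + G.prob hS B s.1 (bad s.1) := by
        rw [Finset.sum_add_distrib, ← Finset.sum_mul, G.sum_weight, one_mul]
        refine congrArg _ (Finset.sum_congr rfl fun A _ => ?_)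
        split_ifs <;> rfl
    _ < δ := by linarith

end

end Network

end PLANet

end

theorem mainTheorem5 (V : PLANet.Signatures) (B : PLANet.BaseSeq V) (hB : B.Admissible)
    (G : PLANet.Network V) (kap kap' : ℕ) (ih : G.InductionHypothesis B kap kap')
    (lam gam : ℕ) (hgam : kap' ≤ gam) (X : Type) [Finite X]
    (p : PLANet.ClosureType (PLANet.Sig.full V) lam X)
    (pτ : PLANet.ClosureType (PLANet.Sig.base V) (lam + kap + gam) X) :
    G.Converges G.closed_full B
      (p.toQuery B (PLANet.Sig.full V) subset_rfl)
      (pτ.toQuery B (PLANet.Sig.full V) (PLANet.Sig.full V).tau_subset) := by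
  have hST : G.sig'.carrier ⊆ (PLANet.Sig.full V).carrier := Set.subset_univ _
  have hpar : ∀ R : PLANet.NewSym G.sig' (PLANet.Sig.full V), (G.parSig R.1).carrier ⊆
      G.sig'.carrier :=
    fun R => G.parSig_subset_sig' R.1
  choose χ hχ using fun R : PLANet.NewSym G.sig' (PLANet.Sig.full V) => ih.elimination R.1
  obtain ⟨I, _, t, c, hsum⟩ := G.exists_sum_bern_basicProb_eq (B := B) G.closed_sig' χ
    (Nat.le_add_right (lam + kap) gam) p pτ
  have hconv : ∀ i, ∃ α, Filter.Tendsto (fun s : Σ n, X → B.dom n =>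
      G.prob G.closed_sig' B s.1 fun A => (t i).Sat B s.1 A.1 s.2)
      (PLANet.realizationFilter B pτ) (nhds α) := fun i =>
    (G.converges_iff_tendsto _ _ _ _).mp (ih.convergence (lam + kap) gam hgam X (t i) pτ)
  choose α hα using hconv
  refine (G.converges_iff_tendsto _ _ _ _).mpr ⟨∑ i, c i * α i, ?_⟩
  -- The probability of `p` is asymptotic to a fixed combination of convergent probabilities.
  have h₁ := G.tendsto_prob_sub_sum_bern hST G.closed_sig' G.closed_full hpar χ hχ
    (show lam ≤ lam + kap + gam by omega) p pτ
  have h₂ := tendsto_finsetSum Finset.univ fun i _ => (hα i).const_mul (c i)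
  have h₃ := h₁.add h₂
  rw [zero_add] at h₃
  refine h₃.congr' (PLANet.eventually_realizationFilter.mpr ⟨1, fun n _ a ha => ?_⟩)
  rw [hsum n a ha]
  exact sub_add_cancel _ _
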